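/- Consider the planar double drone–bar system: drones of masses $m_1,m_2>0$ at $\xi_1=(y_1,z_1)$, $\xi_2=(y_2,z_2)$ are joined by two cables of the same length $l>0$ to the two ends of a bar of length $a>0$ and mass $m_3>0$ with centre $\xi_3=(y_3,z_3)$. The generalized coordinates are $q=(y,z,\theta_1,\theta_2,\theta_3)$, and $$\xi_1=(y,z),\quad \xi_2=(y+l\sin\theta_1+l\sin\theta_2+a\cos\theta_3,\; z-l\cos\theta_1+l\cos\theta_2+a\sin\theta_3),\quad \xi_3=(y+l\sin\theta_1+\tfrac a2\cos\theta_3,\; z-l\cos\theta_1+\tfrac a2\sin\theta_3).$$ The inertia matrix $M(q)$ is given by $\tfrac12\dot q^{T}M(q)\dot q=\tfrac12\left(m_1|\dot\xi_1|^2+m_2|\dot\xi_2|^2+m_3|\dot\xi_3|^2\right)$, and the Lagrangian is $L=\tfrac12\dot q^{T}M(q)\dot q-g(m_1z_1+m_2z_2+m_3z_3)$ with $g>0$. A motion is a twice differentiable solution of $\frac{d}{dt}\frac{\partial L}{\partial\dot q_i}-\frac{\partial L}{\partial q_i}=Q_i$, $i=1,\dots,5$, where $$Q_1=f_1\sin\phi_1+f_2\sin\phi_2,\qquad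 Q_2=f_1\cos\phi_1+f_2\cos\phi_2,\qquad Q_3=l\,(f_2\sin\phi_2\cos\theta_1+f_2\cos\phi_2\sin\theta_1),$$ $$Q_4=l\,(f_2\sin\phi_2\cos\theta_2-f_2\cos\phi_2\sin\theta_2),\qquad Q_5=a\,(-f_2\sin\phi_2\sin\theta_3+f_2\cos\phi_2\cos\theta_3).$$ Let the constant desired positions $(y_{1d},z_{1d})$, $(y_{2d},z_{2d})$ satisfy $y_{2d}-y_{1d}=a$ and $z_{1d}=z_{2d}$; put $e_{y_i}=y_i-y_{id}$, $e_{z_i}=z_i-z_{id}$, $e_{\xi_i}=(e_{y_i},e_{z_i})$, $e_y=e_{y_1}-e_{y_2}$, and let the outer-loop controller be $$f_1\sin\phi_1=-k_{p_1}e_{y_1}-k_{d_1}\dot y_1-k_{a_1}|\dot\Theta|^2\dot y_1-\frac{\sigma\rho e_y}{(\rho-e_y^2)^2},\qquad f_2\sin\phi_2=-k_{p_2}e_{y_2}-k_{d_2}\dot y_2-k_{a_2}|\dot\Theta|^2\dot y_2+\frac{\sigma\rho e_y}{(\rho-e_y^2)^2},$$ $$f_1\cos\phi_1=-k_{p_3}e_{z_1}-k_{d_3}\dot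 z_1+\tfrac12(2m_1+m_3)g,\qquad f_2\cos\phi_2=-k_{p_4}e_{z_2}-k_{d_4}\dot z_2+\tfrac12(2m_2+m_3)g,$$ with $\Theta=(\theta_1,\theta_2,\theta_3)$ and all gains and $\sigma,\rho$ positive. (The desired cable angles are $0$.) Then the desired state $q=(y_{1d},z_{1d},0,0,0)$, $\dot q=0$ is an asymptotically stable equilibrium of the closed loop: it is an equilibrium, it is Lyapunov stable, and every motion on $[0,\infty)$ that starts close enough to it converges to it. Moreover, let $q$ be any motion on $[0,\infty)$ with $\rho>|e_{y_1}(0)-e_{y_2}(0)|^2$ such that for all $t\ge0$ one has $-\frac\pi2<\theta_1,\theta_2,\theta_3<\frac\pi2$, and $\cos(\theta_1-\theta_3)>0$ and $\cos(\theta_2+\theta_3)>0$ (the bar is below both drones and in a straight line with neither cable), and such that $\max\{\cos(\theta_1-\theta_3),\cos(\theta_2+\theta_3)\}\ge\varepsilon$ for all $t\ge0$ and some $\varepsilon>0$ (the motion stays away from the configurations in which both cables are in line with the bar, where $M(q)$ is singular). Then $$\lim_{t\to\infty}e_{\xi_1}=0,\qquad \lim_{t\to\infty}e_{\xi_2}=0,\qquad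 \lim_{t\to\infty}\Theta=0,\qquad \lim_{t\to\infty}\dot q=0 .$$ -/

import Mathlib

open Real Filter Topology Set

noncomputable section

namespace DroneBar

/-- Physical parameters: masses of the two drones and of the bar, common length `l` of the two
cables, length `a` of the bar, gravity acceleration `g`. -/
structure Plant where
  m1 : ℝ
  m2 : ℝ
  m3 : ℝ
  l : ℝ
  a : ℝ
  g : ℝ
  m1_pos : 0 < m1
  m2_pos : 0 < m2
  m3_pos : 0 < m3
  l_pos : 0 < l
  a_pos : 0 < a
  g_pos : 0 < g

/-- Control gains, with the barrier constant `ρ`. -/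
structure Gains where
  kp1 : ℝ
  kp2 : ℝ
  kp3 : ℝ
  kp4 : ℝ
  kd1 : ℝ
  kd2 : ℝ
  kd3 : ℝ
  kd4 : ℝ
  ka1 : ℝ
  ka2 : ℝ
  σ : ℝ
  ρ : ℝ
  kp1_pos : 0 < kp1
  kp2_pos : 0 < kp2
  kp3_pos : 0 < kp3
  kp4_pos : 0 < kp4
  kd1_pos : 0 < kd1
  kd2_pos : 0 < kd2
  kd3_pos : 0 < kd3
  kd4_pos : 0 < kd4
  ka1_pos : 0 < ka1
  ka2_pos : 0 < ka2
  σ_pos : 0 < σ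
  ρ_pos : 0 < ρ

/-- Desired (constant) positions of the two drones. They are compatible with the plant when the
drones are to hover at the same height, at horizontal distance `a`. -/
structure Target (p : Plant) where
  y1d : ℝ
  z1d : ℝ
  y2d : ℝ
  z2d : ℝ
  y_rel : y2d - y1d = p.a
  z_rel : z1d = z2d

/-- Desired cable angle. -/
def theta2d : ℝ := 0

/-- Generalized coordinates `q = (y, z, θ₁, θ₂, θ₃)`; the same type is used for velocities. -/
abbrev Conf := Fin 5 → ℝ

variable (p : Plant) (k : Gains) (d : Target p)

/-! Positions of the drones and of the centre of the bar -/

def y1 (q : Conf) : ℝ := q 0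
def z1 (q : Conf) : ℝ := q 1
def y2 (q : Conf) : ℝ := q 0 + p.l * sin (q 2) + p.l * sin (q 3) + p.a * cos (q 4)
def z2 (q : Conf) : ℝ := q 1 - p.l * cos (q 2) + p.l * cos (q 3) + p.a * sin (q 4)
def z3 (q : Conf) : ℝ := q 1 - p.l * cos (q 2) + p.a / 2 * sin (q 4)

/-! Velocities of the drones, as functions of `q` and of `v = q̇` -/

def y1dot (v : Conf) : ℝ := v 0
def z1dot (v : Conf) : ℝ := v 1
def y2dot (q v : Conf) : ℝ :=
  v 0 + p.l * cos (q 2) * v 2 + p.l * cos (q 3) * v 3 - p.a * sin (q 4) * v 4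
def z2dot (q v : Conf) : ℝ :=
  v 1 + p.l * sin (q 2) * v 2 - p.l * sin (q 3) * v 3 + p.a * cos (q 4) * v 4

/-- The inertia matrix `M(q)`. -/
def inertia (q : Conf) : Matrix (Fin 5) (Fin 5) ℝ :=
  let m13 := p.m2 * p.l * cos (q 2) + p.m3 * p.l * cos (q 2)
  let m14 := p.m2 * p.l * cos (q 3)
  let m15 := -p.m2 * p.a * sin (q 4) - p.m3 * (p.a / 2) * sin (q 4)
  let m23 := p.m2 * p.l * sin (q 2) + p.m3 * p.l * sin (q 2)
  let m24 := -p.m2 * p.l * sin (q 3)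
  let m25 := p.m2 * p.a * cos (q 4) + p.m3 * (p.a / 2) * cos (q 4)
  let m33 := p.m2 * p.l ^ 2 + p.m3 * p.l ^ 2
  let m34 := p.m2 * p.l * p.l * cos (q 2 + q 3)
  let m35 := p.m2 * p.l * p.a * sin (q 2 - q 4) + p.m3 * p.l * (p.a / 2) * sin (q 2 - q 4)
  let m44 := p.m2 * p.l ^ 2
  let m45 := -p.m2 * p.l * p.a * sin (q 3 + q 4)
  let m55 := p.m2 * p.a ^ 2 + p.m3 * (p.a / 2) ^ 2
  let m := p.m1 + p.m2 + p.m3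
  !![m,   0,   m13, m14, m15;
     0,   m,   m23, m24, m25;
     m13, m23, m33, m34, m35;
     m14, m24, m34, m44, m45;
     m15, m25, m35, m45, m55]

/-- The Lagrangian: kinetic energy minus gravitational potential energy. -/
def lagrangian (q v : Conf) : ℝ :=
  1 / 2 * (v ⬝ᵥ (inertia p q).mulVec v)
    - (p.m1 * p.g * z1 q + p.m2 * p.g * z2 p q + p.m3 * p.g * z3 p q)

/-- `∂L/∂qᵢ` -/
def dLdq (i : Fin 5) (q v : Conf) : ℝ :=
  deriv (fun x => lagrangian p (Function.update q i x) v) (q i)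

/-- `∂L/∂q̇ᵢ` -/
def dLdv (i : Fin 5) (q v : Conf) : ℝ :=
  deriv (fun x => lagrangian p q (Function.update v i x)) (v i)

/-- The generalized forces produced by the thrust components
`f1s = f₁ sin φ₁`, `f1c = f₁ cos φ₁`, `f2s = f₂ sin φ₂`, `f2c = f₂ cos φ₂`. -/
def genForce (q : Conf) (f1s f1c f2s f2c : ℝ) : Conf :=
  ![f1s + f2s,
    f1c + f2c,
    f2s * p.l * cos (q 2) + f2c * p.l * sin (q 2),
    f2s * p.l * cos (q 3) - f2c * p.l * sin (q 3),
    -f2s * p.a * sin (q 4) + f2c * p.a * cos (q 4)]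

/-! Position errors -/

variable {p}

def ey1 (q : Conf) : ℝ := y1 q - d.y1d
def ez1 (q : Conf) : ℝ := z1 q - d.z1d
def ey2 (q : Conf) : ℝ := y2 p q - d.y2d
def ez2 (q : Conf) : ℝ := z2 p q - d.z2d
def ey (q : Conf) : ℝ := ey1 d q - ey2 d q

/-! The controller -/

/-- The barrier term. -/
def barrier (q : Conf) : ℝ := k.σ * k.ρ * ey d q / (k.ρ - ey d q ^ 2) ^ 2

/-- `θ̇₁² + θ̇₂² + θ̇₃²` -/
def swingSq (v : Conf) : ℝ := v 2 ^ 2 + v 3 ^ 2 + v 4 ^ 2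

/-- `f₁ sin φ₁` -/
def u1s (q v : Conf) : ℝ :=
  -k.kp1 * ey1 d q - k.kd1 * y1dot v - k.ka1 * swingSq v * y1dot v
    - 1 / 2 * p.m3 * p.g * tan theta2d - barrier k d q

/-- `f₂ sin φ₂` -/
def u2s (q v : Conf) : ℝ :=
  -k.kp2 * ey2 d q - k.kd2 * y2dot p q v - k.ka2 * swingSq v * y2dot p q v
    + 1 / 2 * p.m3 * p.g * tan theta2d + barrier k d q

/-- `f₁ cos φ₁` -/
def u1c (q v : Conf) : ℝ :=
  -k.kp3 * ez1 d q - k.kd3 * z1dot v + 1 / 2 * (2 * p.m1 + p.m3) * p.g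

/-- `f₂ cos φ₂` -/
def u2c (q v : Conf) : ℝ :=
  -k.kp4 * ez2 d q - k.kd4 * z2dot p q v + 1 / 2 * (2 * p.m2 + p.m3) * p.g

/-- `(q, v)` is a motion of the closed loop on the time interval `I`: `q` is twice differentiable
with `q̇ = v`, and the Euler–Lagrange equations `d/dt (∂L/∂q̇ᵢ) - ∂L/∂qᵢ = Qᵢ` hold, with the
generalized forces produced by the controller. -/
structure IsMotion (I : Set ℝ) (q v : ℝ → Conf) : Prop where
  deriv_q : ∀ t ∈ I, HasDerivWithinAt q (v t) I t
  diff_v : DifferentiableOn ℝ v I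
  euler_lagrange : ∀ t ∈ I, ∀ i : Fin 5,
    HasDerivWithinAt (fun s => dLdv p i (q s) (v s))
      (dLdq p i (q t) (v t) +
        genForce p (q t) (u1s k d (q t) (v t)) (u1c k d (q t) (v t))
          (u2s k d (q t) (v t)) (u2c k d (q t) (v t)) i) I t

/-- The desired configuration: drones at their desired positions, all angles zero. -/
def qd : Conf := ![d.y1d, d.z1d, 0, 0, 0]

/-- The desired configuration at rest is an equilibrium of the closed loop. -/
def IsEquilibrium : Prop := IsMotion k d univ (fun _ => qd d) (fun _ => 0)

/-- Lyapunov stability of the desired equilibrium in the state space of pairs `(q, q̇)`. -/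
def IsLyapunovStable : Prop :=
  ∀ ε > 0, ∃ δ > 0, ∀ (τ : ℝ) (q v : ℝ → Conf), IsMotion k d (Ico 0 τ) q v →
    dist (q 0, v 0) (qd d, 0) < δ → ∀ t ∈ Ico 0 τ, dist (q t, v t) (qd d, 0) < ε

/-- Convergence to the desired equilibrium: the position errors, the swing angles, and all the
velocities tend to zero. -/
structure Converges (q v : ℝ → Conf) : Prop where
  ey1_lim : Tendsto (fun t => ey1 d (q t)) atTop (𝓝 0)
  ez1_lim : Tendsto (fun t => ez1 d (q t)) atTop (𝓝 0)
  ey2_lim : Tendsto (fun t => ey2 d (q t)) atTop (𝓝 0)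
  ez2_lim : Tendsto (fun t => ez2 d (q t)) atTop (𝓝 0)
  th1_lim : Tendsto (fun t => q t 2) atTop (𝓝 0)
  th2_lim : Tendsto (fun t => q t 3) atTop (𝓝 0)
  th3_lim : Tendsto (fun t => q t 4) atTop (𝓝 0)
  vel_lim : Tendsto v atTop (𝓝 0)

/-- Local attractivity of the desired equilibrium. -/
def IsLocallyAttractive : Prop :=
  ∃ δ > 0, ∀ q v : ℝ → Conf, IsMotion k d (Ici 0) q v →
    dist (q 0, v 0) (qd d, 0) < δ → Converges d q v

/-- The standing assumption on the angles along a motion. The distances of the two drones from the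
line of the bar, counted positive above it, are `l cos (θ₁ - θ₃)` and `l cos (θ₂ + θ₃)`; so
`cable1` and `cable2` say that the bar is below both drones and in a straight line with neither
cable. The inertia matrix is singular exactly where both these cosines vanish, and `nondeg` says
that the motion does not come arbitrarily close to such configurations. -/
structure AngleAssumption (q : ℝ → Conf) : Prop where
  th1 : ∀ t ≥ 0, -(π / 2) < q t 2 ∧ q t 2 < π / 2
  th2 : ∀ t ≥ 0, -(π / 2) < q t 3 ∧ q t 3 < π / 2
  th3 : ∀ t ≥ 0, -(π / 2) < q t 4 ∧ q t 4 < π / 2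
  cable1 : ∀ t ≥ 0, 0 < cos (q t 2 - q t 4)
  cable2 : ∀ t ≥ 0, 0 < cos (q t 3 + q t 4)
  nondeg : ∃ ε > 0, ∀ t ≥ 0, ε ≤ max (cos (q t 2 - q t 4)) (cos (q t 3 + q t 4))

end DroneBar

end

/-! The proportional, gravity and barrier terms of the controller derive from a potential with
minimum at the target, so the closed loop is a damped mechanical system: its total energy decreases
at exactly the rate `dissipation` (`energy_balance`). The barrier part of the energy keeps `ey ^ 2`
below `ρ` (`IsMotion.energy_le`), and positivity of the energy near the target (`energy_pos`) gives
Lyapunov stability.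

The damping acts on the drones only, so convergence needs more than energy decay. The argument is of
Barbalat type and uses neither a flow nor uniqueness of solutions; its main tool is
`SlowlyVarying.tendsto_zero`: a slowly varying derivative of a bounded function tends to zero. On a
compact region where `M(q)` is nonsingular, the dissipation tends to zero, hence so do both drone
velocities. Then the two translational forces vary slowly, so they tend to zero, and by a second
application so does the total linear momentum. What remains after removing the drones' share is the
momentum of the bar; thus the kinetic energy and, by coercivity of `M(q)`, all velocities vanish in
the limit (`StaysIn.vel_tendsto`). Now the whole state varies slowly, all generalized forces tend to
zero, and every cluster point of `q` is a rest point (`StaysIn.conf_tendsto`).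

Uniqueness of the rest point is statics (`hanging_balance`): both cable tensions are nonnegative,
and a nonzero horizontal tension contradicts either the horizontal spring-and-barrier law or the
heights of the drones. Local attractivity follows because stability confines nearby motions to a
region where the angle assumption holds. -/

namespace DroneBar


/-! ### Explicit form of the Lagrangian derivatives -/

/-- The generalized momenta `M(q) v`. -/
noncomputable def momentum (p : Plant) (q v : Conf) : Conf := (inertia p q).mulVec v

/-- The derivative of `M(q)` along the direction `v`. -/
noncomputable def inertiaRate (p : Plant) (q v : Conf) : Matrix (Fin 5) (Fin 5) ℝ :=
  let m13 := -(p.m2 + p.m3) * p.l * sin (q 2) * v 2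
  let m14 := -p.m2 * p.l * sin (q 3) * v 3
  let m15 := -(p.m2 + p.m3 / 2) * p.a * cos (q 4) * v 4
  let m23 := (p.m2 + p.m3) * p.l * cos (q 2) * v 2
  let m24 := -p.m2 * p.l * cos (q 3) * v 3
  let m25 := -(p.m2 + p.m3 / 2) * p.a * sin (q 4) * v 4
  let m34 := -p.m2 * p.l * p.l * sin (q 2 + q 3) * (v 2 + v 3)
  let m35 := (p.m2 + p.m3 / 2) * p.l * p.a * cos (q 2 - q 4) * (v 2 - v 4)
  let m45 := -p.m2 * p.l * p.a * cos (q 3 + q 4) * (v 3 + v 4)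
  !![0,   0,   m13, m14, m15;
     0,   0,   m23, m24, m25;
     m13, m23, 0,   m34, m35;
     m14, m24, m34, 0,   m45;
     m15, m25, m35, m45, 0]

/-- The explicit gradient of the Lagrangian in `q`. -/
noncomputable def lagrangianGrad (p : Plant) (q v : Conf) : Conf :=
  ![0,
    -(p.m1 + p.m2 + p.m3) * p.g,
    (v 1 * v 2 * (p.m2 + p.m3) * p.l - v 2 * v 3 * p.m2 * p.l ^ 2 * sin (q 3)
        + v 2 * v 4 * (p.m2 + p.m3 / 2) * p.l * p.a * cos (q 4)) * cos (q 2)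
      - (v 0 * v 2 * (p.m2 + p.m3) * p.l + v 2 * v 3 * p.m2 * p.l ^ 2 * cos (q 3)
        - v 2 * v 4 * (p.m2 + p.m3 / 2) * p.l * p.a * sin (q 4)
        + p.g * (p.m2 + p.m3) * p.l) * sin (q 2),
    (-v 1 * v 3 * p.m2 * p.l - v 2 * v 3 * p.m2 * p.l ^ 2 * sin (q 2)
        - v 3 * v 4 * p.m2 * p.l * p.a * cos (q 4)) * cos (q 3)
      - (v 0 * v 3 * p.m2 * p.l + v 2 * v 3 * p.m2 * p.l ^ 2 * cos (q 2)
        - v 3 * v 4 * p.m2 * p.l * p.a * sin (q 4) - p.g * p.m2 * p.l) * sin (q 3),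
    ((p.m2 + p.m3 / 2) * p.a * (-v 0 * v 4 - v 2 * v 4 * p.l * cos (q 2) - p.g)
        - v 3 * v 4 * p.m2 * p.l * p.a * cos (q 3)) * cos (q 4)
      - ((p.m2 + p.m3 / 2) * p.a * (v 1 * v 4 + v 2 * v 4 * p.l * sin (q 2))
        - v 3 * v 4 * p.m2 * p.l * p.a * sin (q 3)) * sin (q 4)]

theorem momentum_apply (p : Plant) (q v : Conf) (i : Fin 5) :
    momentum p q v i = ∑ j, inertia p q i j * v j := rfl

/-- The Lagrangian is exactly quadratic in each velocity, so its partial derivative can be read off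
from an algebraic identity. The next lemma does the same for a coordinate, which enters only
linearly and through its sine and cosine. -/
theorem hasDerivAt_of_eq_quadratic {f : ℝ → ℝ} {x₀ m c : ℝ}
    (h : ∀ x, f x = f x₀ + m * (x - x₀) + c * (x - x₀) ^ 2) : HasDerivAt f m x₀ := by
  rw [funext h]
  have h1 : HasDerivAt (fun x : ℝ => x - x₀) 1 x₀ := (hasDerivAt_id x₀).sub_const x₀
  exact (((hasDerivAt_const x₀ (f x₀)).add (h1.const_mul m)).add
    ((h1.pow 2).const_mul c)).congr_deriv (by simp)

theorem hasDerivAt_of_eq_trig {f : ℝ → ℝ} {x₀ b c e : ℝ}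
    (h : ∀ x, f x = f x₀ + b * (sin x - sin x₀) + c * (cos x - cos x₀) + e * (x - x₀)) :
    HasDerivAt f (b * cos x₀ - c * sin x₀ + e) x₀ := by
  rw [funext h]
  exact ((((hasDerivAt_const x₀ (f x₀)).add
    (((hasDerivAt_sin x₀).sub_const (sin x₀)).const_mul b)).add
    (((hasDerivAt_cos x₀).sub_const (cos x₀)).const_mul c)).add
    (((hasDerivAt_id x₀).sub_const x₀).const_mul e)).congr_deriv (by simp; ring)

theorem lagrangian_eq (p : Plant) (q v : Conf) :
    lagrangian p q v =
      1 / 2 * ((p.m1 + p.m2 + p.m3) * (v 0 ^ 2 + v 1 ^ 2)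
        + (p.m2 + p.m3) * p.l ^ 2 * v 2 ^ 2 + p.m2 * p.l ^ 2 * v 3 ^ 2
        + (p.m2 + p.m3 / 4) * p.a ^ 2 * v 4 ^ 2)
      + (p.m2 + p.m3) * p.l * v 2 * (v 0 * cos (q 2) + v 1 * sin (q 2))
      + p.m2 * p.l * v 3 * (v 0 * cos (q 3) - v 1 * sin (q 3))
      + (p.m2 + p.m3 / 2) * p.a * v 4 * (v 1 * cos (q 4) - v 0 * sin (q 4))
      + p.m2 * p.l ^ 2 * v 2 * v 3 * (cos (q 2) * cos (q 3) - sin (q 2) * sin (q 3))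
      + (p.m2 + p.m3 / 2) * p.l * p.a * v 2 * v 4
        * (sin (q 2) * cos (q 4) - cos (q 2) * sin (q 4))
      - p.m2 * p.l * p.a * v 3 * v 4 * (sin (q 3) * cos (q 4) + cos (q 3) * sin (q 4))
      - p.g * ((p.m1 + p.m2 + p.m3) * q 1 - (p.m2 + p.m3) * p.l * cos (q 2)
        + p.m2 * p.l * cos (q 3) + (p.m2 + p.m3 / 2) * p.a * sin (q 4)) := by
  simp only [lagrangian, dotProduct, Matrix.mulVec, Fin.sum_univ_five, inertia, z1, z2, z3]
  simp [cos_add, sin_sub, sin_add]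
  ring

theorem dLdv_eq (p : Plant) (i : Fin 5) (q v : Conf) : dLdv p i q v = momentum p q v i := by
  refine (hasDerivAt_of_eq_quadratic (c := 1 / 2 * inertia p q i i) fun x => ?_).deriv
  simp only [lagrangian_eq, momentum_apply, Fin.sum_univ_five]
  fin_cases i <;> simp [inertia, cos_add, sin_sub, sin_add] <;> ring

theorem dLdq_eq (p : Plant) (i : Fin 5) (q v : Conf) : dLdq p i q v = lagrangianGrad p q v i := by
  refine HasDerivAt.deriv ?_
  fin_cases i
  · refine (hasDerivAt_of_eq_trig (b := 0) (c := 0) (e := 0) fun x => ?_).congr_deriv ?_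
    · simp [lagrangian_eq]
    · simp [lagrangianGrad]
  · refine (hasDerivAt_of_eq_trig (b := 0) (c := 0) (e := -(p.m1 + p.m2 + p.m3) * p.g)
      fun x => ?_).congr_deriv ?_
    · simp [lagrangian_eq]; ring
    · simp [lagrangianGrad]
  · refine (hasDerivAt_of_eq_trig (e := 0)
      (b := v 1 * v 2 * (p.m2 + p.m3) * p.l - v 2 * v 3 * p.m2 * p.l ^ 2 * sin (q 3)
        + v 2 * v 4 * (p.m2 + p.m3 / 2) * p.l * p.a * cos (q 4))
      (c := v 0 * v 2 * (p.m2 + p.m3) * p.l + v 2 * v 3 * p.m2 * p.l ^ 2 * cos (q 3)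
        - v 2 * v 4 * (p.m2 + p.m3 / 2) * p.l * p.a * sin (q 4)
        + p.g * (p.m2 + p.m3) * p.l) fun x => ?_).congr_deriv ?_
    · simp [lagrangian_eq]; ring
    · simp [lagrangianGrad]
  · refine (hasDerivAt_of_eq_trig (e := 0)
      (b := -v 1 * v 3 * p.m2 * p.l - v 2 * v 3 * p.m2 * p.l ^ 2 * sin (q 2)
        - v 3 * v 4 * p.m2 * p.l * p.a * cos (q 4))
      (c := v 0 * v 3 * p.m2 * p.l + v 2 * v 3 * p.m2 * p.l ^ 2 * cos (q 2)
        - v 3 * v 4 * p.m2 * p.l * p.a * sin (q 4) - p.g * p.m2 * p.l) fun x => ?_).congr_deriv ?_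
    · simp [lagrangian_eq]; ring
    · simp [lagrangianGrad]
  · refine (hasDerivAt_of_eq_trig (e := 0)
      (b := (p.m2 + p.m3 / 2) * p.a * (-v 0 * v 4 - v 2 * v 4 * p.l * cos (q 2) - p.g)
        - v 3 * v 4 * p.m2 * p.l * p.a * cos (q 3))
      (c := (p.m2 + p.m3 / 2) * p.a * (v 1 * v 4 + v 2 * v 4 * p.l * sin (q 2))
        - v 3 * v 4 * p.m2 * p.l * p.a * sin (q 3)) fun x => ?_).congr_deriv ?_
    · simp [lagrangian_eq]; ring
    · simp [lagrangianGrad]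

theorem hasDerivWithinAt_inertia (p : Plant) {I : Set ℝ} {q : ℝ → Conf} {w : Conf} {t : ℝ}
    (h : HasDerivWithinAt q w I t) (i j : Fin 5) :
    HasDerivWithinAt (fun s => inertia p (q s) i j) (inertiaRate p (q t) w i j) I t := by
  have h' := hasDerivWithinAt_pi.1 h
  have s2 := (h' 2).sin
  have c2 := (h' 2).cos
  have s3 := (h' 3).sin
  have c3 := (h' 3).cos
  have s4 := (h' 4).sin
  have c4 := (h' 4).cos
  have c23 := ((h' 2).add (h' 3)).cos
  have s24 := ((h' 2).sub (h' 4)).sin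
  have s34 := ((h' 3).add (h' 4)).sin
  have h02 := (c2.const_mul (p.m2 * p.l)).add (c2.const_mul (p.m3 * p.l))
  have h03 := c3.const_mul (p.m2 * p.l)
  have h04 := (s4.const_mul (-p.m2 * p.a)).sub (s4.const_mul (p.m3 * (p.a / 2)))
  have h12 := (s2.const_mul (p.m2 * p.l)).add (s2.const_mul (p.m3 * p.l))
  have h13 := s3.const_mul (-p.m2 * p.l)
  have h14 := (c4.const_mul (p.m2 * p.a)).add (c4.const_mul (p.m3 * (p.a / 2)))
  have h23 := c23.const_mul (p.m2 * p.l * p.l)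
  have h24 := (s24.const_mul (p.m2 * p.l * p.a)).add (s24.const_mul (p.m3 * p.l * (p.a / 2)))
  have h34 := s34.const_mul (-p.m2 * p.l * p.a)
  fin_cases i <;> fin_cases j <;> simp only [inertia, inertiaRate, Matrix.of_apply,
    Matrix.cons_val', Matrix.cons_val, Matrix.cons_val_zero, Matrix.cons_val_one, Fin.zero_eta,
    Fin.mk_one, Fin.reduceFinMk, Matrix.cons_val_fin_one]
  all_goals first
    | exact hasDerivWithinAt_const ..
    | exact h02.congr_deriv (by ring) | exact h03.congr_deriv (by ring) | exact h04.congr_deriv (by ring)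
    | exact h12.congr_deriv (by ring) | exact h13.congr_deriv (by ring) | exact h14.congr_deriv (by ring)
    | exact h23.congr_deriv (by simp; ring) | exact h24.congr_deriv (by simp; ring)
    | exact h34.congr_deriv (by simp; ring)

theorem inertia_symm (p : Plant) (q : Conf) (i j : Fin 5) : inertia p q i j = inertia p q j i := by
  fin_cases i <;> fin_cases j <;> rfl

/-- Velocity of the centre of the bar. -/
noncomputable def y3dot (p : Plant) (q v : Conf) : ℝ :=
  v 0 + p.l * cos (q 2) * v 2 - p.a / 2 * sin (q 4) * v 4
noncomputable def z3dot (p : Plant) (q v : Conf) : ℝ :=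
  v 1 + p.l * sin (q 2) * v 2 + p.a / 2 * cos (q 4) * v 4

/-- Confirms that the matrix is the one defined by the kinetic energies of the three bodies; the
squares of the angular velocities account for the uses of `sin_sq_add_cos_sq`. -/
theorem dotProduct_momentum (p : Plant) (q v : Conf) :
    v ⬝ᵥ momentum p q v = p.m1 * (y1dot v ^ 2 + z1dot v ^ 2)
      + p.m2 * (y2dot p q v ^ 2 + z2dot p q v ^ 2)
      + p.m3 * (y3dot p q v ^ 2 + z3dot p q v ^ 2) := by
  simp only [momentum, dotProduct, Matrix.mulVec, Fin.sum_univ_five, inertia, y1dot, z1dot,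
    y2dot, z2dot, y3dot, z3dot]
  simp [cos_add, sin_sub, sin_add]
  linear_combination
    -(p.m2 + p.m3) * p.l ^ 2 * v 2 ^ 2 * sin_sq_add_cos_sq (q 2)
    - p.m2 * p.l ^ 2 * v 3 ^ 2 * sin_sq_add_cos_sq (q 3)
    - (p.m2 + p.m3 / 4) * p.a ^ 2 * v 4 ^ 2 * sin_sq_add_cos_sq (q 4)


variable {p : Plant} {k : Gains} {d : Target p}

/-! ### Equations of motion and energy balance -/

/-- The right-hand side of the Euler–Lagrange equations of the closed loop. -/
noncomputable def totalForce (k : Gains) (d : Target p) (q v : Conf) (i : Fin 5) : ℝ :=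
  lagrangianGrad p q v i +
    genForce p q (u1s k d q v) (u1c k d q v) (u2s k d q v) (u2c k d q v) i

/-- The potential energy of the closed loop, normalized to vanish at the target. -/
noncomputable def potential (k : Gains) (d : Target p) (q : Conf) : ℝ :=
  1 / 2 * (k.kp1 * ey1 d q ^ 2 + k.kp2 * ey2 d q ^ 2 + k.kp3 * ez1 d q ^ 2 + k.kp4 * ez2 d q ^ 2)
    + p.m3 * p.g * p.l / 2 * (2 - cos (q 2) - cos (q 3))
    + k.σ / 2 * (ey d q ^ 2 / (k.ρ - ey d q ^ 2))

/-- The total energy of the closed loop. -/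
noncomputable def energy (k : Gains) (d : Target p) (q v : Conf) : ℝ :=
  1 / 2 * (v ⬝ᵥ momentum p q v) + potential k d q

/-- The power dissipated by the damping terms of the controller. -/
noncomputable def dissipation (p : Plant) (k : Gains) (q v : Conf) : ℝ :=
  (k.kd1 + k.ka1 * swingSq v) * y1dot v ^ 2 + (k.kd2 + k.ka2 * swingSq v) * y2dot p q v ^ 2
    + k.kd3 * z1dot v ^ 2 + k.kd4 * z2dot p q v ^ 2

theorem IsMotion.mono {I J : Set ℝ} {q v : ℝ → Conf} (h : IsMotion k d I q v) (hJ : J ⊆ I) :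
    IsMotion k d J q v where
  deriv_q t ht := (h.deriv_q t (hJ ht)).mono hJ
  diff_v := h.diff_v.mono hJ
  euler_lagrange t ht i := (h.euler_lagrange t (hJ ht) i).mono hJ

theorem IsMotion.hasDerivWithinAt_momentum {I : Set ℝ} {q v : ℝ → Conf} (h : IsMotion k d I q v)
    {t : ℝ} (ht : t ∈ I) (i : Fin 5) :
    HasDerivWithinAt (fun s => momentum p (q s) (v s) i) (totalForce k d (q t) (v t) i) I t := by
  have := h.euler_lagrange t ht i
  simp only [dLdv_eq, dLdq_eq] at this
  exact this

/-- The product rule for `M(q) v` and the Euler–Lagrange equation give the same derivative, once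
derivatives within `I` are unique. -/
theorem IsMotion.accel_eq {I : Set ℝ} {q v : ℝ → Conf} (h : IsMotion k d I q v)
    {t : ℝ} (ht : t ∈ I) (hI : UniqueDiffWithinAt ℝ I t) {w : Conf}
    (hw : HasDerivWithinAt v w I t) (i : Fin 5) :
    (inertiaRate p (q t) (v t)).mulVec (v t) i + momentum p (q t) w i
      = totalForce k d (q t) (v t) i := by
  have h1 : HasDerivWithinAt (fun s => ∑ j, inertia p (q s) i j * v s j)
      (∑ j, (inertiaRate p (q t) (v t) i j * v t j + inertia p (q t) i j * w j)) I t :=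
    HasDerivWithinAt.fun_sum fun j _ =>
      (hasDerivWithinAt_inertia p (h.deriv_q t ht) i j).mul (hasDerivWithinAt_pi.1 hw j)
  have h2 := hI.eq_deriv _ h1 (h.hasDerivWithinAt_momentum ht i)
  rw [← h2, Finset.sum_add_distrib]
  rfl

theorem dotProduct_momentum_comm (p : Plant) (q v w : Conf) :
    v ⬝ᵥ momentum p q w = w ⬝ᵥ momentum p q v := by
  have hs : (inertia p q).transpose = inertia p q := by
    ext i j; exact inertia_symm p q j i
  rw [momentum, momentum, Matrix.dotProduct_mulVec, dotProduct_comm, ← Matrix.mulVec_transpose, hs]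

/-- The inertial terms do no net work. The constant thrusts carry the drones and half of the bar
each, which cancels gravity except for `m₃ g l / 2 * (2 - cos θ₁ - cos θ₂)`; the other conservative
terms cancel against the gradient of `potential`, and only damping remains. -/
theorem energy_balance (k : Gains) (d : Target p) (q v : Conf) :
    v ⬝ᵥ totalForce k d q v - 1 / 2 * (v ⬝ᵥ (inertiaRate p q v).mulVec v)
      + (k.kp1 * ey1 d q * v 0 + k.kp2 * ey2 d q * y2dot p q v + k.kp3 * ez1 d q * v 1
        + k.kp4 * ez2 d q * z2dot p q v
        + p.m3 * p.g * p.l / 2 * (sin (q 2) * v 2 + sin (q 3) * v 3)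
        + barrier k d q * (v 0 - y2dot p q v)) = -dissipation p k q v := by
  simp only [dotProduct, Matrix.mulVec, Fin.sum_univ_five, totalForce, dissipation, inertiaRate,
    lagrangianGrad, genForce, u1s, u1c, u2s, u2c, theta2d, y1dot, z1dot, tan_zero]
  simp [cos_add, cos_sub, sin_add]
  simp only [y2dot, z2dot]
  ring

theorem hasDerivWithinAt_ey {I : Set ℝ} {q : ℝ → Conf} {w : Conf} {t : ℝ}
    (h : HasDerivWithinAt q w I t) :
    HasDerivWithinAt (fun s => ey1 d (q s)) (w 0) I t ∧
    HasDerivWithinAt (fun s => ez1 d (q s)) (w 1) I t ∧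
    HasDerivWithinAt (fun s => ey2 d (q s)) (y2dot p (q t) w) I t ∧
    HasDerivWithinAt (fun s => ez2 d (q s)) (z2dot p (q t) w) I t := by
  have h' := hasDerivWithinAt_pi.1 h
  refine ⟨(h' 0).sub_const _, (h' 1).sub_const _, ?_, ?_⟩
  · exact (((((h' 0).add ((h' 2).sin.const_mul p.l)).add ((h' 3).sin.const_mul p.l)).add
      ((h' 4).cos.const_mul p.a)).sub_const _).congr_deriv (by simp only [y2dot]; ring)
  · exact (((((h' 1).sub ((h' 2).cos.const_mul p.l)).add ((h' 3).cos.const_mul p.l)).add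
      ((h' 4).sin.const_mul p.a)).sub_const _).congr_deriv (by simp only [z2dot]; ring)

/-- The barrier force comes from `d/de (e² / (ρ - e²)) = 2ρe / (ρ - e²)²`. -/
theorem hasDerivWithinAt_potential {I : Set ℝ} {q : ℝ → Conf} {w : Conf} {t : ℝ}
    (h : HasDerivWithinAt q w I t) (hρ : ey d (q t) ^ 2 < k.ρ) :
    HasDerivWithinAt (fun s => potential k d (q s))
      (k.kp1 * ey1 d (q t) * w 0 + k.kp2 * ey2 d (q t) * y2dot p (q t) w
        + k.kp3 * ez1 d (q t) * w 1 + k.kp4 * ez2 d (q t) * z2dot p (q t) w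
        + p.m3 * p.g * p.l / 2 * (sin (q t 2) * w 2 + sin (q t 3) * w 3)
        + barrier k d (q t) * (w 0 - y2dot p (q t) w)) I t := by
  have h' := hasDerivWithinAt_pi.1 h
  obtain ⟨h1, h2, h3, h4⟩ := hasDerivWithinAt_ey (d := d) h
  have h5 : HasDerivWithinAt (fun s => ey d (q s)) (w 0 - y2dot p (q t) w) I t := h1.sub h3
  have hne : k.ρ - ey d (q t) ^ 2 ≠ 0 := by linarith
  have h6 : HasDerivWithinAt (fun s => k.σ / 2 * (ey d (q s) ^ 2 / (k.ρ - ey d (q s) ^ 2)))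
      (barrier k d (q t) * (w 0 - y2dot p (q t) w)) I t := by
    refine (((h5.pow 2).div ((h5.pow 2).const_sub k.ρ) hne).const_mul (k.σ / 2)).congr_deriv ?_
    simp only [barrier, Pi.pow_apply]
    field_simp
    simp
    ring
  have h7 := (((((h1.pow 2).const_mul k.kp1).add ((h3.pow 2).const_mul k.kp2)).add
    ((h2.pow 2).const_mul k.kp3)).add ((h4.pow 2).const_mul k.kp4)).const_mul (1 / 2)
  have h8 := (((h' 2).cos.const_sub 2).sub (h' 3).cos).const_mul (p.m3 * p.g * p.l / 2)
  refine ((h7.add h8).add h6).congr_deriv ?_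
  simp
  ring

theorem IsMotion.hasDerivWithinAt_energy {I : Set ℝ} {q v : ℝ → Conf} (h : IsMotion k d I q v)
    {t : ℝ} (ht : t ∈ I) (hI : UniqueDiffWithinAt ℝ I t) (hρ : ey d (q t) ^ 2 < k.ρ) :
    HasDerivWithinAt (fun s => energy k d (q s) (v s)) (-dissipation p k (q t) (v t)) I t := by
  have hw := (h.diff_v t ht).hasDerivWithinAt
  set w := derivWithin v I t
  have hK : HasDerivWithinAt (fun s => ∑ i, v s i * momentum p (q s) (v s) i)
      (∑ i, (w i * momentum p (q t) (v t) i + v t i * totalForce k d (q t) (v t) i)) I t :=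
    HasDerivWithinAt.fun_sum fun i _ =>
      (hasDerivWithinAt_pi.1 hw i).mul (h.hasDerivWithinAt_momentum ht i)
  refine ((hK.const_mul (1 / 2)).add
    (hasDerivWithinAt_potential (h.deriv_q t ht) hρ)).congr_deriv ?_
  rw [← energy_balance, Finset.sum_add_distrib]
  have h1 : ∑ i, w i * momentum p (q t) (v t) i = v t ⬝ᵥ momentum p (q t) w :=
    dotProduct_momentum_comm p (q t) w (v t)
  have h2 : totalForce k d (q t) (v t)
      = (inertiaRate p (q t) (v t)).mulVec (v t) + momentum p (q t) w :=
    funext fun i => (h.accel_eq ht hI hw i).symm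
  have h3 : ∑ i, v t i * totalForce k d (q t) (v t) i = v t ⬝ᵥ totalForce k d (q t) (v t) := rfl
  -- By symmetry of `M`, the unknown term with the acceleration becomes `v·F - v·Ṁv`, so the kinetic
  -- energy has rate `v·F - ½ v·Ṁv`.
  have h4 : v t ⬝ᵥ momentum p (q t) w = v t ⬝ᵥ totalForce k d (q t) (v t)
      - v t ⬝ᵥ (inertiaRate p (q t) (v t)).mulVec (v t) := by
    rw [h2, dotProduct_add]; ring
  rw [h1, h3, h4]
  ring

/-! ### Energy bounds and invariance of the barrier region -/

theorem swingSq_nonneg (v : Conf) : 0 ≤ swingSq v := by unfold swingSq; positivity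

theorem dissipation_nonneg (p : Plant) (k : Gains) (q v : Conf) : 0 ≤ dissipation p k q v := by
  have := swingSq_nonneg v
  have := k.kd1_pos; have := k.kd2_pos; have := k.kd3_pos; have := k.kd4_pos
  have := k.ka1_pos; have := k.ka2_pos
  unfold dissipation; positivity

theorem dotProduct_momentum_nonneg (p : Plant) (q v : Conf) : 0 ≤ v ⬝ᵥ momentum p q v := by
  have := p.m1_pos; have := p.m2_pos; have := p.m3_pos
  rw [dotProduct_momentum]; positivity

/-- Elementary lower bounds for the energy inside the barrier. -/
theorem energy_bounds {q v : Conf} {E : ℝ} (hρ : ey d q ^ 2 < k.ρ) (hE : energy k d q v ≤ E) :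
    v ⬝ᵥ momentum p q v ≤ 2 * E ∧ k.kp1 * ey1 d q ^ 2 ≤ 2 * E ∧ k.kp2 * ey2 d q ^ 2 ≤ 2 * E ∧
    k.kp3 * ez1 d q ^ 2 ≤ 2 * E ∧ k.kp4 * ez2 d q ^ 2 ≤ 2 * E ∧
    p.m3 * p.g * p.l * (1 - cos (q 2)) ≤ 2 * E ∧ p.m3 * p.g * p.l * (1 - cos (q 3)) ≤ 2 * E ∧
    k.σ * ey d q ^ 2 ≤ 2 * E * (k.ρ - ey d q ^ 2) := by
  have h0 := dotProduct_momentum_nonneg p q v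
  have h1 := mul_nonneg k.kp1_pos.le (sq_nonneg (ey1 d q))
  have h2 := mul_nonneg k.kp2_pos.le (sq_nonneg (ey2 d q))
  have h3 := mul_nonneg k.kp3_pos.le (sq_nonneg (ez1 d q))
  have h4 := mul_nonneg k.kp4_pos.le (sq_nonneg (ez2 d q))
  have hm : 0 < p.m3 * p.g * p.l := mul_pos (mul_pos p.m3_pos p.g_pos) p.l_pos
  have h5 := mul_nonneg hm.le (sub_nonneg.2 (cos_le_one (q 2)))
  have h6 := mul_nonneg hm.le (sub_nonneg.2 (cos_le_one (q 3)))
  have hr : 0 < k.ρ - ey d q ^ 2 := by linarith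
  have h7 : 0 ≤ k.σ * (ey d q ^ 2 / (k.ρ - ey d q ^ 2)) :=
    mul_nonneg k.σ_pos.le (div_nonneg (sq_nonneg _) hr.le)
  simp only [energy, potential] at hE
  refine ⟨by linarith, by linarith, by linarith, by linarith, by linarith, by linarith,
    by linarith, ?_⟩
  -- With the denominator cleared, the barrier bound is a closed condition that survives passage to
  -- the limit `ey ^ 2 → ρ`.
  have h8 : k.σ * (ey d q ^ 2 / (k.ρ - ey d q ^ 2)) ≤ 2 * E := by linarith
  rwa [← mul_div_assoc, div_le_iff₀ hr] at h8

theorem continuous_ey : Continuous (ey d) := by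
  unfold ey ey1 ey2 y1 y2; fun_prop

/-- Along a motion that starts inside the barrier, the barrier is never reached and the energy
never exceeds its initial value. -/
theorem IsMotion.energy_le {τ : ℝ} {q v : ℝ → Conf} (h : IsMotion k d (Ico 0 τ) q v)
    (h0 : ey d (q 0) ^ 2 < k.ρ) {t : ℝ} (ht : t ∈ Ico 0 τ) :
    ey d (q t) ^ 2 < k.ρ ∧ energy k d (q t) (v t) ≤ energy k d (q 0) (v 0) := by
  have anti : ∀ {T : ℝ}, T ≤ τ → (∀ s ∈ Ico 0 T, ey d (q s) ^ 2 < k.ρ) → ∀ s ∈ Ico 0 T,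
      energy k d (q s) (v s) ≤ energy k d (q 0) (v 0) := by
    intro T hT hb s hs
    have hm := h.mono (Ico_subset_Ico_right hT)
    have hd : ∀ s ∈ Ico 0 T, HasDerivWithinAt (fun s => energy k d (q s) (v s))
        (-dissipation p k (q s) (v s)) (Ico 0 T) s := fun s hs =>
      hm.hasDerivWithinAt_energy hs (uniqueDiffOn_Ico 0 T s hs) (hb s hs)
    refine antitoneOn_of_hasDerivWithinAt_nonpos (convex_Ico 0 T)
      (fun s hs => (hd s hs).continuousWithinAt)
      (fun s hs => (hd s (interior_subset hs)).mono interior_subset)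
      (fun s _ => neg_nonpos.2 (dissipation_nonneg ..)) ⟨le_rfl, hs.1.trans_lt hs.2⟩ hs hs.1
  have hcont : ContinuousOn (fun s => ey d (q s) ^ 2) (Ico 0 τ) := by
    have hq : ContinuousOn q (Ico 0 τ) := fun s hs => (h.deriv_q s hs).continuousWithinAt
    exact (continuous_ey.comp_continuousOn hq).pow 2
  have key : ∀ s ∈ Ico 0 τ, ey d (q s) ^ 2 < k.ρ := by
    by_contra! hcon
    obtain ⟨s, hs, hsρ⟩ := hcon
    have hsub : Icc 0 s ⊆ Ico 0 τ := fun r hr => ⟨hr.1, hr.2.trans_lt hs.2⟩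
    have hcomp : IsCompact (Icc 0 s ∩ (fun s => ey d (q s) ^ 2) ⁻¹' Ici k.ρ) :=
      isCompact_Icc.of_isClosed_subset
        ((hcont.mono hsub).preimage_isClosed_of_isClosed isClosed_Icc isClosed_Ici)
        inter_subset_left
    -- `r` is the first time at which the barrier is reached. The energy is controlled strictly
    -- before `r`, and the cleared bound passes to `r`, where its left side is at least `σρ > 0` and
    -- its right side at most `0`.
    obtain ⟨r, ⟨hr, hrρ⟩, hmin⟩ := hcomp.exists_isLeast ⟨s, ⟨hs.1, le_rfl⟩, hsρ⟩
    have hb : ∀ u ∈ Ico 0 r, ey d (q u) ^ 2 < k.ρ := by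
      intro u hu
      by_contra! hu'
      exact absurd (hmin ⟨⟨hu.1, hu.2.le.trans hr.2⟩, hu'⟩) (not_le.2 hu.2)
    have hr0 : 0 < r := by
      rcases hr.1.eq_or_lt with h1 | h1
      · subst h1; exact absurd hrρ (not_le.2 h0)
      · exact h1
    have hle := anti (hsub hr).2.le hb
    have hlim : Tendsto (fun u => ey d (q u) ^ 2) (𝓝[Ico 0 r] r) (𝓝 (ey d (q r) ^ 2)) :=
      (hcont r (hsub hr)).mono (Ico_subset_Ico_right (hsub hr).2.le)
    have hne : (𝓝[Ico 0 r] r).NeBot := by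
      rw [← mem_closure_iff_nhdsWithin_neBot, closure_Ico hr0.ne]
      exact ⟨hr.1, le_rfl⟩
    have hfin : k.σ * ey d (q r) ^ 2
        ≤ 2 * energy k d (q 0) (v 0) * (k.ρ - ey d (q r) ^ 2) :=
      le_of_tendsto_of_tendsto (hlim.const_mul _) ((hlim.const_sub _).const_mul _)
        (eventually_mem_nhdsWithin.mono fun u hu =>
          (energy_bounds (hb u hu) (hle u hu)).2.2.2.2.2.2.2)
    have hE : 0 ≤ 2 * energy k d (q 0) (v 0) :=
      (dotProduct_momentum_nonneg p (q 0) (v 0)).trans (energy_bounds h0 le_rfl).1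
    have hrρ' : k.ρ ≤ ey d (q r) ^ 2 := hrρ
    have h1 := mul_pos k.σ_pos k.ρ_pos
    nlinarith [k.σ_pos, mul_nonneg hE (sub_nonneg.2 hrρ'),
      mul_le_mul_of_nonneg_left hrρ' k.σ_pos.le]
  exact ⟨key t ht, anti le_rfl key t ht⟩


/-! ### Slowly varying functions -/

/-- `g` varies slowly at infinity: its oscillation on windows of any fixed length tends to `0`. -/
def SlowlyVarying {X : Type*} [PseudoMetricSpace X] (g : ℝ → X) : Prop :=
  ∀ T > 0, ∀ ε > 0, ∀ᶠ t in atTop, ∀ s ∈ Icc t (t + T), dist (g s) (g t) < ε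

theorem SlowlyVarying.of_tendsto {X : Type*} [PseudoMetricSpace X] {g : ℝ → X} {x : X}
    (h : Tendsto g atTop (𝓝 x)) : SlowlyVarying g := by
  intro T _ ε hε
  filter_upwards [eventually_forall_ge_atTop.2 (Metric.tendsto_nhds.1 h (ε / 2) (half_pos hε))]
    with t ht s hs
  have h1 := ht s hs.1
  have h2 := ht t le_rfl
  calc dist (g s) (g t) ≤ dist (g s) x + dist (g t) x := dist_triangle_right ..
    _ < ε := by linarith

theorem SlowlyVarying.add {E : Type*} [SeminormedAddCommGroup E] {f g : ℝ → E}
    (hf : SlowlyVarying f) (hg : SlowlyVarying g) : SlowlyVarying (fun t => f t + g t) := by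
  intro T hT ε hε
  filter_upwards [hf T hT (ε / 2) (half_pos hε), hg T hT (ε / 2) (half_pos hε)] with t h1 h2 s hs
  calc dist (f s + g s) (f t + g t) ≤ dist (f s) (f t) + dist (g s) (g t) := dist_add_add_le ..
    _ < ε := by linarith [h1 s hs, h2 s hs]

theorem SlowlyVarying.prodMk {X Y : Type*} [PseudoMetricSpace X] [PseudoMetricSpace Y]
    {f : ℝ → X} {g : ℝ → Y} (hf : SlowlyVarying f) (hg : SlowlyVarying g) :
    SlowlyVarying (fun t => (f t, g t)) := by
  intro T hT ε hε
  filter_upwards [hf T hT ε hε, hg T hT ε hε] with t h1 h2 s hs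
  exact max_lt (h1 s hs) (h2 s hs)

theorem SlowlyVarying.comp_continuousOn {X Y : Type*} [PseudoMetricSpace X] [PseudoMetricSpace Y]
    {g : ℝ → X} (hg : SlowlyVarying g) {K : Set X} (hK : IsCompact K) {F : X → Y}
    (hF : ContinuousOn F K) (hgK : ∀ t ≥ 0, g t ∈ K) : SlowlyVarying (fun t => F (g t)) := by
  have hu := hK.uniformContinuousOn_of_continuous hF
  intro T hT ε hε
  obtain ⟨δ, hδ, h⟩ := Metric.uniformContinuousOn_iff.1 hu ε hε
  filter_upwards [hg T hT δ hδ, eventually_ge_atTop 0] with t h1 h2 s hs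
  exact h _ (hgK s (h2.trans hs.1)) _ (hgK t h2) (h1 s hs)

theorem SlowlyVarying.of_deriv {E : Type*} [NormedAddCommGroup E] [NormedSpace ℝ E]
    {g g' : ℝ → E} (h : ∀ t ∈ Ici (0 : ℝ), HasDerivWithinAt g (g' t) (Ici 0) t)
    (h' : Tendsto g' atTop (𝓝 0)) : SlowlyVarying g := by
  intro T hT ε hε
  have hc : 0 < ε / (2 * T) := by positivity
  filter_upwards [eventually_forall_ge_atTop.2 (Metric.tendsto_nhds.1 h' _ hc),
    eventually_ge_atTop 0] with t ht ht0 s hs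
  have := (convex_Ici t).norm_image_sub_le_of_norm_hasDerivWithin_le (C := ε / (2 * T))
    (fun x hx => (h x (ht0.trans hx)).mono (Ici_subset_Ici.2 ht0))
    (fun x hx => by simpa using (ht x hx).le) (self_mem_Ici) (show s ∈ Ici t from hs.1)
  rw [dist_eq_norm]
  refine this.trans_lt ?_
  rw [Real.norm_of_nonneg (by linarith [hs.1])]
  calc ε / (2 * T) * (s - t) ≤ ε / (2 * T) * T :=
        mul_le_mul_of_nonneg_left (by linarith [hs.2]) hc.le
    _ = ε / 2 := by field_simp
    _ < ε := half_lt_self hε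

/-- If `f` is bounded and its derivative varies slowly, then the derivative tends to `0`. -/
theorem SlowlyVarying.tendsto_zero {f g : ℝ → ℝ}
    (h : ∀ t ∈ Ici (0 : ℝ), HasDerivWithinAt f (g t) (Ici 0) t) {B : ℝ}
    (hB : ∀ t ≥ 0, |f t| ≤ B) (hg : SlowlyVarying g) : Tendsto g atTop (𝓝 0) := by
  rw [Metric.tendsto_nhds]
  intro ε hε
  have hB0 : 0 ≤ B := (abs_nonneg _).trans (hB 0 le_rfl)
  -- Over a window of this length the mean slope of `f` is at most `2B / T < ε / 2`; slow variation
  -- carries this from the mean value point to `t`.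
  set T : ℝ := 4 * (B + 1) / ε
  have hT : 0 < T := by positivity
  filter_upwards [hg T hT (ε / 2) (half_pos hε), eventually_ge_atTop 0] with t ht ht0
  have hcont : ContinuousOn f (Icc t (t + T)) := fun x hx =>
    ((h x (ht0.trans hx.1)).continuousWithinAt).mono fun y hy => ht0.trans hy.1
  obtain ⟨s, hs, hs'⟩ := exists_hasDerivAt_eq_slope f g (by linarith : t < t + T) hcont
    (fun x hx => (h x (ht0.trans hx.1.le)).hasDerivAt (Ici_mem_nhds (ht0.trans_lt hx.1)))
  have h1 := ht s ⟨hs.1.le, hs.2.le⟩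
  have h2 : |g s| < ε / 2 := by
    rw [hs', abs_div, add_sub_cancel_left, abs_of_pos hT, div_lt_iff₀ hT]
    have h3 : |f (t + T) - f t| ≤ 2 * B := by
      have := abs_sub (f (t + T)) (f t)
      linarith [hB t ht0, hB (t + T) (by positivity)]
    have h4 : ε / 2 * T = 2 * (B + 1) := by simp only [T]; field_simp; norm_num
    linarith
  rw [Real.dist_eq] at h1 ⊢
  rw [sub_zero]
  have h3 : |g t| ≤ |g s| + |g s - g t| := by
    have := abs_sub (g s) (g s - g t)
    rwa [sub_sub_cancel] at this
  linarith

/-- Barbalat's lemma in the form used for energy dissipation. -/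
theorem tendsto_zero_of_antitone {f D : ℝ → ℝ}
    (h : ∀ t ∈ Ici (0 : ℝ), HasDerivWithinAt f (-D t) (Ici 0) t) {B : ℝ}
    (hB : ∀ t ≥ 0, B ≤ f t) (hD : ∀ t ≥ 0, 0 ≤ D t) (hu : UniformContinuousOn D (Ici 0)) :
    Tendsto D atTop (𝓝 0) := by
  have hanti : AntitoneOn f (Ici 0) := antitoneOn_of_hasDerivWithinAt_nonpos (convex_Ici 0)
    (fun s hs => (h s hs).continuousWithinAt)
    (fun s hs => (h s (interior_subset hs)).mono interior_subset)
    (fun s hs => neg_nonpos.2 (hD s (interior_subset hs)))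
  have hlim : ∃ l, Tendsto f atTop (𝓝 l) := by
    have ha : Antitone fun t => f (max t 0) := fun s t hst =>
      hanti (le_max_right s 0) (le_max_right t 0) (max_le_max hst le_rfl)
    refine ⟨_, (tendsto_atTop_ciInf ha ⟨B, ?_⟩).congr' ?_⟩
    · rintro _ ⟨t, rfl⟩; exact hB _ (le_max_right t 0)
    · filter_upwards [eventually_ge_atTop 0] with t ht
      rw [max_eq_left ht]
  obtain ⟨l, hl⟩ := hlim
  rw [Metric.tendsto_nhds]
  intro ε hε
  obtain ⟨δ, hδ, hδ'⟩ := Metric.uniformContinuousOn_iff.1 hu (ε / 2) (half_pos hε)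
  set c : ℝ := δ / 2
  have hc : 0 < c := half_pos hδ
  have hcδ : c < δ := half_lt_self hδ
  -- The drop of the convergent `f` over a window of length `c` is eventually below `c * ε / 2`, so
  -- `D` is below `ε / 2` somewhere in it; since `c < δ`, uniform continuity bounds `D t`.
  filter_upwards [SlowlyVarying.of_tendsto hl c hc (ε / 2 * c) (by positivity),
    eventually_ge_atTop 0] with t ht ht0
  have hcont : ContinuousOn f (Icc t (t + c)) := fun x hx =>
    ((h x (ht0.trans hx.1)).continuousWithinAt).mono fun y hy => ht0.trans hy.1
  obtain ⟨s, hs, hs'⟩ := exists_hasDerivAt_eq_slope f (fun t => -D t)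
    (by linarith : t < t + c) hcont
    (fun x hx => (h x (ht0.trans hx.1.le)).hasDerivAt (Ici_mem_nhds (ht0.trans_lt hx.1)))
  have h1 := ht (t + c) ⟨by linarith, le_rfl⟩
  have h2 : |D s| < ε / 2 := by
    rw [← abs_neg, hs', abs_div, add_sub_cancel_left, abs_of_pos hc, div_lt_iff₀ hc]
    rwa [Real.dist_eq] at h1
  have h3 := hδ' s (ht0.trans hs.1.le) t ht0 (by
    rw [Real.dist_eq, abs_of_pos (by linarith [hs.1])]; linarith [hs.2])
  rw [Real.dist_eq] at h3
  rw [Real.dist_eq, sub_zero]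
  have h5 : |D t| ≤ |D s| + |D s - D t| := by
    have := abs_sub (D s) (D s - D t)
    rwa [sub_sub_cancel] at this
  linarith


/-! ### Rest points -/

/-- If one cable pushed, the other would have to pull to carry the weight, and the torque balance
would then equate numbers of opposite sign, not both zero. -/
theorem tension_nonneg {τ τ' c c' C C' : ℝ} (hW : 0 < τ * c + τ' * c') (hc : 0 ≤ c)
    (hc' : 0 ≤ c') (hC : 0 ≤ C) (hC' : 0 ≤ C') (hCC : 0 < C ∨ 0 < C') (h : τ * C = τ' * C') :
    0 ≤ τ := by
  by_contra! hneg
  have h1 := mul_nonneg (neg_pos.2 hneg).le hc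
  have h2 : 0 < τ' := by
    by_contra! h2
    linarith [mul_nonneg (neg_nonneg.2 h2) hc']
  rcases hCC with hC₀ | hC₀
  · linarith [mul_pos (neg_pos.2 hneg) hC₀, mul_nonneg h2.le hC']
  · linarith [mul_nonneg (neg_pos.2 hneg).le hC, mul_pos h2 hC₀]

/-- At equal horizontal tension the cable with the greater vertical load hangs closer to the
vertical, because `c / s = F / h`. -/
theorem cos_le_of_steeper {h s c s' c' F F' : ℝ} (hh : 0 < h) (g : s ^ 2 + c ^ 2 = 1)
    (g' : s' ^ 2 + c' ^ 2 = 1) (hc' : 0 ≤ c') (hs' : 0 < s') (hF : 0 ≤ F)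
    (hFF : F < F') (i : h * c = F * s) (i' : h * c' = F' * s') : c ≤ c' := by
  by_contra! hlt
  have h1 : s ≤ s' := abs_le_of_sq_le_sq' (by nlinarith) hs'.le |>.2
  linarith [mul_lt_mul_of_pos_left hlt hh, mul_le_mul_of_nonneg_left h1 hF,
    mul_lt_mul_of_pos_right hFF hs']

theorem le_one_of_sq {s c : ℝ} (h : s ^ 2 + c ^ 2 = 1) : c ≤ 1 := by
  nlinarith [sq_nonneg s]

/-- Balance of forces and torques on a bar hanging on two straight cables: `h` is the horizontal
tension, `A` and `B` the vertical ones, `W` the weight, and `cw` half the difference `B - A`. -/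
theorem hanging_balance {h A B W s₁ c₁ s₂ c₂ s₃ c₃ x₁ x₂ n a l : ℝ}
    (hW : 0 < W) (ha : 0 < a) (hl : 0 < l) (hn : 0 < n)
    (p₁ : s₁ ^ 2 + c₁ ^ 2 = 1) (p₂ : s₂ ^ 2 + c₂ ^ 2 = 1) (p₃ : s₃ ^ 2 + c₃ ^ 2 = 1)
    (hc₁ : 0 ≤ c₁) (hc₂ : 0 ≤ c₂) (hc₃ : 0 ≤ c₃)
    (hC₁ : 0 ≤ c₁ * c₃ + s₁ * s₃) (hC₂ : 0 ≤ c₂ * c₃ - s₂ * s₃)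
    (hC : 0 < c₁ * c₃ + s₁ * s₃ ∨ 0 < c₂ * c₃ - s₂ * s₃)
    (e₁ : h * c₁ = A * s₁) (e₂ : h * c₂ = B * s₂)
    (hAB : A + B = W) (e₃ : 2 * h * s₃ = (B - A) * c₃)
    (hz : -n * (B - A) = l * (c₂ - c₁) + a * s₃)
    (hy : x₁ = a * (1 - c₃) - l * (s₁ + s₂)) (hx : h = x₂ * x₁) (hx₂ : 0 < x₂) :
    x₁ = 0 ∧ B = A ∧ s₁ = 0 ∧ s₂ = 0 ∧ s₃ = 0 := by
  obtain ⟨τ₁, hτ₁⟩ : ∃ τ, τ = h * s₁ + A * c₁ := ⟨_, rfl⟩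
  obtain ⟨τ₂, hτ₂⟩ : ∃ τ, τ = h * s₂ + B * c₂ := ⟨_, rfl⟩
  have t₁ : τ₁ * s₁ = h := by rw [hτ₁]; linear_combination h * p₁ - c₁ * e₁
  have u₁ : τ₁ * c₁ = A := by rw [hτ₁]; linear_combination A * p₁ + s₁ * e₁
  have t₂ : τ₂ * s₂ = h := by rw [hτ₂]; linear_combination h * p₂ - c₂ * e₂
  have u₂ : τ₂ * c₂ = B := by rw [hτ₂]; linear_combination B * p₂ + s₂ * e₂
  have torque : τ₁ * (c₁ * c₃ + s₁ * s₃) = τ₂ * (c₂ * c₃ - s₂ * s₃) := by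
    linear_combination c₃ * u₁ + s₃ * t₁ - c₃ * u₂ + s₃ * t₂ + e₃
  have q₁ : c₁ ≤ 1 := le_one_of_sq p₁
  have q₂ : c₂ ≤ 1 := le_one_of_sq p₂
  have q₃ : c₃ ≤ 1 := le_one_of_sq p₃
  have hW' : 0 < τ₁ * c₁ + τ₂ * c₂ := by linarith
  have n₁ : 0 ≤ τ₁ := tension_nonneg hW' hc₁ hc₂ hC₁ hC₂ hC torque
  have n₂ : 0 ≤ τ₂ := tension_nonneg (by linarith) hc₂ hc₁ hC₂ hC₁ hC.symm torque.symm
  have hA : 0 ≤ A := u₁ ▸ mul_nonneg n₁ hc₁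
  have hB : 0 ≤ B := u₂ ▸ mul_nonneg n₂ hc₂
  have one_of {s c : ℝ} (h1 : s ^ 2 + c ^ 2 = 1) (hc : 0 ≤ c) (hs : s = 0) : c = 1 := by
    subst hs; nlinarith
  -- A vertical bar is treated apart: there `e₃` forces `h = 0` but says nothing about `B - A`. One
  -- cable then carries the whole weight vertically, and the sign in `hz` is wrong.
  rcases hc₃.eq_or_lt with hc0 | hc0
  · exfalso
    subst hc0
    have hs : s₃ ≠ 0 := by rintro rfl; norm_num at p₃
    have hh : h = 0 := by
      have : h * s₃ = 0 := by linarith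
      exact (mul_eq_zero.1 this).resolve_right hs
    have hx0 : x₁ = 0 := (mul_eq_zero.1 (hx.symm.trans hh)).resolve_left hx₂.ne'
    have hsum : 0 < s₁ + s₂ := by
      by_contra! hcon
      linarith [mul_nonneg hl.le (neg_nonneg.2 hcon)]
    have hs' : s₃ = 1 ∨ s₃ = -1 := by
      have : (s₃ - 1) * (s₃ + 1) = 0 := by linear_combination p₃
      rcases mul_eq_zero.1 this with h1 | h1
      · left; linarith
      · right; linarith
    rcases hs' with rfl | rfl
    · have hs1 : 0 < s₁ := by linarith
      have hA0 : A = 0 := by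
        have : A * s₁ = 0 := by rw [← e₁, hh, zero_mul]
        exact (mul_eq_zero.1 this).resolve_right hs1.ne'
      have hs2 : s₂ = 0 := by
        have : B * s₂ = 0 := by rw [← e₂, hh, zero_mul]
        exact (mul_eq_zero.1 this).resolve_left (by linarith)
      rw [one_of p₂ hc₂ hs2, hA0, show B = W by linarith] at hz
      linarith [mul_nonneg hl.le (sub_nonneg.2 q₁), mul_pos hn hW]
    · have hs2 : 0 < s₂ := by linarith
      have hB0 : B = 0 := by
        have : B * s₂ = 0 := by rw [← e₂, hh, zero_mul]
        exact (mul_eq_zero.1 this).resolve_right hs2.ne'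
      have hs1 : s₁ = 0 := by
        have : A * s₁ = 0 := by rw [← e₁, hh, zero_mul]
        exact (mul_eq_zero.1 this).resolve_left (by linarith)
      rw [one_of p₁ hc₁ hs1, hB0, show A = W by linarith] at hz
      linarith [mul_nonneg hl.le (sub_nonneg.2 q₂), mul_pos hn hW]
  · rcases lt_trichotomy h 0 with hh | hh | hh
    -- For `h < 0` both cables lean so that `x₁ > 0`, against `h = x₂ * x₁`.
    · exfalso
      have hs1 : s₁ < 0 := by
        by_contra! h1; linarith [mul_nonneg n₁ h1]
      have hs2 : s₂ < 0 := by
        by_contra! h1; linarith [mul_nonneg n₂ h1]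
      have : 0 < x₁ := by
        linarith [mul_nonneg ha.le (sub_nonneg.2 q₃), mul_pos hl (neg_pos.2 hs1),
          mul_pos hl (neg_pos.2 hs2)]
      linarith [mul_pos hx₂ this]
    · have hx0 : x₁ = 0 := (mul_eq_zero.1 (hx.symm.trans hh)).resolve_left hx₂.ne'
      have hBA : B = A := by
        have : (B - A) * c₃ = 0 := by rw [← e₃, hh]; ring
        linarith [(mul_eq_zero.1 this).resolve_right hc0.ne']
      have hs1 : s₁ = 0 := by
        have : A * s₁ = 0 := by rw [← e₁, hh, zero_mul]
        exact (mul_eq_zero.1 this).resolve_left (by linarith)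
      have hs2 : s₂ = 0 := by
        have : B * s₂ = 0 := by rw [← e₂, hh, zero_mul]
        exact (mul_eq_zero.1 this).resolve_left (by linarith)
      have hs3 : a * s₃ = 0 := by
        rw [one_of p₁ hc₁ hs1, one_of p₂ hc₂ hs2, hBA] at hz; linarith
      exact ⟨hx0, hBA, hs1, hs2, (mul_eq_zero.1 hs3).resolve_left ha.ne'⟩
    · exfalso
      have hs1 : 0 < s₁ := by
        by_contra! h1; linarith [mul_nonneg n₁ (neg_nonneg.2 h1)]
      have hs2 : 0 < s₂ := by
        by_contra! h1; linarith [mul_nonneg n₂ (neg_nonneg.2 h1)]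
      have hx0 : 0 < x₁ := by
        by_contra! h1; linarith [mul_nonneg hx₂.le (neg_nonneg.2 h1)]
      -- For `h > 0` a tilted bar loads one cable more; that cable is steeper, and the two sides of
      -- `hz` get opposite signs. A level bar gives `x₁ < 0`.
      rcases lt_trichotomy s₃ 0 with h3 | h3 | h3
      · have hBA : B < A := by
          by_contra! h4
          linarith [mul_nonneg (sub_nonneg.2 h4) hc₃, mul_pos hh (neg_pos.2 h3)]
        have := cos_le_of_steeper hh p₂ p₁ hc₁ hs1 hB hBA e₂ e₁
        linarith [mul_pos hn (sub_pos.2 hBA), mul_nonneg hl.le (sub_nonneg.2 this),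
          mul_pos ha (neg_pos.2 h3)]
      · have := one_of p₃ hc₃ h3
        subst this
        linarith [mul_pos hl hs1, mul_pos hl hs2]
      · have hBA : A < B := by
          by_contra! h4
          linarith [mul_nonneg (sub_nonneg.2 h4) hc₃, mul_pos hh h3]
        have := cos_le_of_steeper hh p₁ p₂ hc₂ hs2 hA hBA e₁ e₂
        linarith [mul_pos hn (sub_pos.2 hBA), mul_nonneg hl.le (sub_nonneg.2 this),
          mul_pos ha h3]

theorem ey_eq (d : Target p) (q : Conf) :
    ey d q = p.a * (1 - cos (q 4)) - p.l * (sin (q 2) + sin (q 3)) := by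
  have := d.y_rel
  simp only [ey, ey1, ey2, y1, y2]; linarith

theorem ez2_sub_ez1 (d : Target p) (q : Conf) :
    ez2 d q - ez1 d q = p.l * (cos (q 3) - cos (q 2)) + p.a * sin (q 4) := by
  have := d.z_rel
  simp only [ez1, ez2, z1, z2]; linarith

/-- A configuration is the target once all its errors vanish and its angles are small. -/
theorem eq_qd {q : Conf} (h2 : q 2 ∈ Icc (-(π / 2)) (π / 2)) (h3 : q 3 ∈ Icc (-(π / 2)) (π / 2))
    (h4 : q 4 ∈ Icc (-(π / 2)) (π / 2)) (e1 : ey1 d q = 0) (e2 : ez1 d q = 0)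
    (s2 : sin (q 2) = 0) (s3 : sin (q 3) = 0) (s4 : sin (q 4) = 0) : q = qd d := by
  have zero {x : ℝ} (hx : x ∈ Icc (-(π / 2)) (π / 2)) (hs : sin x = 0) : x = 0 :=
    injOn_sin hx ⟨by linarith [pi_pos], by linarith [pi_pos]⟩ (hs.trans sin_zero.symm)
  simp only [ey1, ez1, y1, z1] at e1 e2
  ext i
  fin_cases i
  · simpa [qd] using sub_eq_zero.1 e1
  · simpa [qd] using sub_eq_zero.1 e2
  · simpa [qd] using zero h2 s2
  · simpa [qd] using zero h3 s3
  · simpa [qd] using zero h4 s4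

/-- The only rest point of the closed loop in the closed admissible region is the target. -/
theorem eq_qd_of_totalForce_eq_zero {q : Conf} (h2 : q 2 ∈ Icc (-(π / 2)) (π / 2))
    (h3 : q 3 ∈ Icc (-(π / 2)) (π / 2)) (h4 : q 4 ∈ Icc (-(π / 2)) (π / 2))
    (hC₁ : 0 ≤ cos (q 2 - q 4)) (hC₂ : 0 ≤ cos (q 3 + q 4))
    (hC : 0 < max (cos (q 2 - q 4)) (cos (q 3 + q 4)))
    (h : ∀ i, totalForce k d q 0 i = 0) : q = qd d := by
  have hp1 := k.kp1_pos; have hp2 := k.kp2_pos; have hp3 := k.kp3_pos; have hp4 := k.kp4_pos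
  have E0 : k.kp1 * ey1 d q + k.kp2 * ey2 d q = 0 := by
    have := h 0
    simp [totalForce, lagrangianGrad, genForce, u1s, u2s, theta2d, y1dot, y2dot] at this
    linarith
  have E1 : k.kp3 * ez1 d q + k.kp4 * ez2 d q = 0 := by
    have := h 1
    simp [totalForce, lagrangianGrad, genForce, u1c, u2c, z1dot, z2dot] at this
    linarith
  -- `t` and `B` are the horizontal and vertical forces that the second drone, net of its own
  -- weight, exerts through its cable; the first cable carries `m₃ g - B`.
  obtain ⟨t, ht⟩ : ∃ t, t = -k.kp2 * ey2 d q + barrier k d q := ⟨_, rfl⟩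
  obtain ⟨B, hB⟩ : ∃ B, B = -k.kp4 * ez2 d q + p.m3 * p.g / 2 := ⟨_, rfl⟩
  have E2 : t * cos (q 2) = (p.m3 * p.g - B) * sin (q 2) := by
    have := h 2
    simp [totalForce, lagrangianGrad, genForce, u2c, u2s, theta2d, z2dot, y2dot] at this
    apply mul_left_cancel₀ p.l_pos.ne'
    rw [ht, hB]
    linear_combination this
  have E3 : t * cos (q 3) = B * sin (q 3) := by
    have := h 3
    simp [totalForce, lagrangianGrad, genForce, u2c, u2s, theta2d, z2dot, y2dot] at this
    apply mul_left_cancel₀ p.l_pos.ne'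
    rw [ht, hB]
    linear_combination this
  have E4 : 2 * t * sin (q 4) = (B - (p.m3 * p.g - B)) * cos (q 4) := by
    have := h 4
    simp [totalForce, lagrangianGrad, genForce, u2c, u2s, theta2d, z2dot, y2dot] at this
    apply mul_left_cancel₀ p.a_pos.ne'
    rw [ht, hB]
    linear_combination -2 * this
  have hez1 : ez1 d q = -(k.kp4 / k.kp3) * ez2 d q := by field_simp; linarith
  have hey1 : ey1 d q = k.kp2 / (k.kp1 + k.kp2) * ey d q := by
    simp only [ey]; field_simp; linarith
  have hey2 : ey2 d q = -(k.kp1 / (k.kp1 + k.kp2)) * ey d q := by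
    simp only [ey]; field_simp; linarith
  rw [cos_sub] at hC₁ hC
  rw [cos_add] at hC₂ hC
  have key := hanging_balance (W := p.m3 * p.g) (n := (1 + k.kp4 / k.kp3) / (2 * k.kp4))
    (x₁ := ey d q) (x₂ := k.kp2 * (k.kp1 / (k.kp1 + k.kp2)) + k.σ * k.ρ / (k.ρ - ey d q ^ 2) ^ 2)
    (mul_pos p.m3_pos p.g_pos) p.a_pos p.l_pos (by positivity)
    (sin_sq_add_cos_sq (q 2)) (sin_sq_add_cos_sq (q 3)) (sin_sq_add_cos_sq (q 4))
    (cos_nonneg_of_mem_Icc h2) (cos_nonneg_of_mem_Icc h3) (cos_nonneg_of_mem_Icc h4)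
    hC₁ hC₂ (lt_max_iff.1 hC) E2 E3 (by ring) E4 ?_ (ey_eq d q) ?_ ?_
  · obtain ⟨k1, k2, k3, k4, k5⟩ := key
    have hz : ez2 d q = 0 := by
      have : k.kp4 * ez2 d q = 0 := by linarith
      exact (mul_eq_zero.1 this).resolve_left hp4.ne'
    exact eq_qd h2 h3 h4 (by rw [hey1, k1, mul_zero]) (by rw [hez1, hz, mul_zero]) k3 k4 k5
  · rw [← ez2_sub_ez1, hez1, hB]; field_simp; ring
  · rw [ht, hey2, barrier]; ring
  · have := mul_pos k.σ_pos k.ρ_pos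
    -- This also holds for `ey ^ 2 = ρ`, where the quotient is `0` by convention, so no barrier
    -- condition is needed.
    have : 0 ≤ k.σ * k.ρ / (k.ρ - ey d q ^ 2) ^ 2 := by positivity
    have : 0 < k.kp2 * (k.kp1 / (k.kp1 + k.kp2)) := by positivity
    linarith


/-! ### Nonsingularity of the inertia matrix, continuity -/

theorem momentum_continuous (p : Plant) : Continuous fun x : Conf × Conf => momentum p x.1 x.2 := by
  have hM : Continuous (inertia p) := by
    refine continuous_pi fun i => continuous_pi fun j => ?_
    fin_cases i <;> fin_cases j <;> simp [inertia] <;> fun_prop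
  exact Continuous.matrix_mulVec (hM.comp continuous_fst) continuous_snd

theorem inertiaRate_mulVec_continuous (p : Plant) :
    Continuous fun x : Conf × Conf => (inertiaRate p x.1 x.2).mulVec x.2 := by
  have hM : Continuous fun x : Conf × Conf => inertiaRate p x.1 x.2 := by
    refine continuous_pi fun i => continuous_pi fun j => ?_
    fin_cases i <;> fin_cases j <;> simp [inertiaRate] <;> fun_prop
  exact Continuous.matrix_mulVec hM continuous_snd

theorem kinetic_continuous (p : Plant) :
    Continuous fun x : Conf × Conf => x.2 ⬝ᵥ momentum p x.1 x.2 :=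
  Continuous.dotProduct continuous_snd (momentum_continuous p)

/-- The inertia matrix is positive definite where one of the two cables is not in line with
the bar. -/
theorem dotProduct_momentum_pos {q v : Conf}
    (h : 0 < max (cos (q 2 - q 4)) (cos (q 3 + q 4))) (hv : v ≠ 0) :
    0 < v ⬝ᵥ momentum p q v := by
  refine lt_of_le_of_ne (dotProduct_momentum_nonneg p q v) fun h0 => hv ?_
  have m1 := p.m1_pos; have m2 := p.m2_pos; have m3 := p.m3_pos
  rw [dotProduct_momentum] at h0
  have sq0 {m x y : ℝ} (hm : 0 < m) (hxy : m * (x ^ 2 + y ^ 2) ≤ 0) : x = 0 ∧ y = 0 := by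
    have : x ^ 2 + y ^ 2 ≤ 0 := by
      by_contra! h1; exact absurd hxy (not_le.2 (mul_pos hm h1))
    constructor <;> nlinarith [sq_nonneg x, sq_nonneg y]
  have g1 : 0 ≤ p.m1 * (y1dot v ^ 2 + z1dot v ^ 2) := by positivity
  have g2 : 0 ≤ p.m2 * (y2dot p q v ^ 2 + z2dot p q v ^ 2) := by positivity
  have g3 : 0 ≤ p.m3 * (y3dot p q v ^ 2 + z3dot p q v ^ 2) := by positivity
  obtain ⟨a1, b1⟩ := sq0 m1 (by linarith : p.m1 * (y1dot v ^ 2 + z1dot v ^ 2) ≤ 0)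
  obtain ⟨a2, b2⟩ := sq0 m2 (by linarith : p.m2 * (y2dot p q v ^ 2 + z2dot p q v ^ 2) ≤ 0)
  obtain ⟨a3, b3⟩ := sq0 m3 (by linarith : p.m3 * (y3dot p q v ^ 2 + z3dot p q v ^ 2) ≤ 0)
  simp only [y1dot, z1dot] at a1 b1
  simp only [y2dot, z2dot, y3dot, z3dot, a1, b1, zero_add] at a2 b2 a3 b3
  have hl := p.l_pos.ne'
  have ha := p.a_pos.ne'
  have unit (x : ℝ) := sin_sq_add_cos_sq x
  -- cable 1 and the left half of the bar, cable 2 and the right half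
  have r1 : p.l * v 2 * cos (q 2 - q 4) = 0 := by
    rw [cos_sub]; linear_combination cos (q 4) * a3 + sin (q 4) * b3
  have r2 : p.l * v 3 * cos (q 3 + q 4) = 0 := by
    rw [cos_add]; linear_combination cos (q 4) * (a2 - a3) + sin (q 4) * (b2 - b3)
  -- Projecting on the direction of a cable removes its swing and leaves the rotation of the bar.
  have r3 : p.a / 2 * v 4 * cos (q 2 - q 4) = 0 := by
    rw [cos_sub]; linear_combination -sin (q 2) * a3 + cos (q 2) * b3
  have r4 : p.a / 2 * v 4 * cos (q 3 + q 4) = 0 := by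
    rw [cos_add]; linear_combination sin (q 3) * (a2 - a3) + cos (q 3) * (b2 - b3)
  have v4 : v 4 = 0 := by
    rcases lt_max_iff.1 h with h | h
    · simpa [h.ne', ha] using r3
    · simpa [h.ne', ha] using r4
  rw [v4] at a2 a3 b2 b3
  have v2 : p.l * v 2 = 0 := by
    linear_combination cos (q 2) * a3 + sin (q 2) * b3 - p.l * v 2 * unit (q 2)
  have v3 : p.l * v 3 = 0 := by
    linear_combination cos (q 3) * (a2 - a3) - sin (q 3) * (b2 - b3) - p.l * v 3 * unit (q 3)
  ext i
  fin_cases i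
  · exact a1
  · exact b1
  · exact (mul_eq_zero.1 v2).resolve_left hl
  · exact (mul_eq_zero.1 v3).resolve_left hl
  · exact v4

/-- Minimum over the compact `K × unit sphere`, extended by homogeneity of degree two in `v`. -/
theorem exists_kinetic_lower_bound (p : Plant) {K : Set Conf} (hK : IsCompact K)
    (h : ∀ q ∈ K, 0 < max (cos (q 2 - q 4)) (cos (q 3 + q 4))) :
    ∃ c > 0, ∀ q ∈ K, ∀ v, c * ‖v‖ ^ 2 ≤ v ⬝ᵥ momentum p q v := by
  rcases K.eq_empty_or_nonempty with rfl | hne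
  · exact ⟨1, one_pos, by simp⟩
  have hS : IsCompact (K ×ˢ Metric.sphere (0 : Conf) 1) := hK.prod (isCompact_sphere _ _)
  obtain ⟨x, ⟨hx1, hx2⟩, hmin⟩ := hS.exists_isMinOn
    (hne.prod (NormedSpace.sphere_nonempty.2 zero_le_one)) (kinetic_continuous p).continuousOn
  have hx0 : x.2 ≠ 0 := by
    intro h0; rw [mem_sphere_zero_iff_norm, h0, norm_zero] at hx2; exact zero_ne_one hx2
  refine ⟨_, dotProduct_momentum_pos (p := p) (h _ hx1) hx0, fun q hq v => ?_⟩
  rcases eq_or_ne v 0 with rfl | hv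
  · simp
  have hn : 0 < ‖v‖ := norm_pos_iff.2 hv
  have hmem : (q, ‖v‖⁻¹ • v) ∈ K ×ˢ Metric.sphere (0 : Conf) 1 :=
    ⟨hq, by simp [norm_smul, hn.ne']⟩
  have h1 := isMinOn_iff.1 hmin _ hmem
  simp only [momentum, Matrix.mulVec_smul, smul_dotProduct, dotProduct_smul, smul_eq_mul] at h1
  simp only [momentum]
  calc _ ≤ (‖v‖⁻¹ * (‖v‖⁻¹ * v ⬝ᵥ (inertia p q).mulVec v)) * ‖v‖ ^ 2 :=
        mul_le_mul_of_nonneg_right h1 (sq_nonneg _)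
    _ = _ := by field_simp

theorem totalForce_continuousOn (k : Gains) (d : Target p) :
    ContinuousOn (fun x : Conf × Conf => totalForce k d x.1 x.2) {x | ey d x.1 ^ 2 < k.ρ} := by
  have hb : ContinuousOn (fun x : Conf × Conf => barrier k d x.1) {x | ey d x.1 ^ 2 < k.ρ} := by
    have hc : Continuous fun x : Conf × Conf => ey d x.1 := continuous_ey.comp continuous_fst
    refine ContinuousOn.div (continuous_const.mul hc).continuousOn
      ((continuous_const.sub (hc.pow 2)).pow 2).continuousOn fun x hx => ?_
    have : ey d x.1 ^ 2 < k.ρ := hx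
    exact pow_ne_zero _ (by linarith)
  refine continuousOn_pi.2 fun i => ?_
  simp only [totalForce, u1s, u1c, u2s, u2c, ey1, ey2, ez1, ez2, y1, y2, z1, z2, y1dot, z1dot,
    y2dot, z2dot, swingSq]
  fin_cases i <;> simp [lagrangianGrad, genForce] <;> fun_prop

theorem dissipation_continuous (p : Plant) (k : Gains) :
    Continuous fun x : Conf × Conf => dissipation p k x.1 x.2 := by
  simp only [dissipation, y1dot, z1dot, y2dot, z2dot, swingSq]
  fun_prop


/-! ### Convergence of motions in compact regions -/

theorem tendsto_zero_of_mul_sq_le {f D : ℝ → ℝ} {c : ℝ} (hc : 0 < c)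
    (h : ∀ t, c * f t ^ 2 ≤ D t) (hD : Tendsto D atTop (𝓝 0)) : Tendsto f atTop (𝓝 0) := by
  have h1 : Tendsto (fun t => f t ^ 2) atTop (𝓝 0) :=
    squeeze_zero (fun t => sq_nonneg _)
      (fun t => (le_div_iff₀' hc).2 (h t)) (by simpa using hD.div_const c)
  have h2 := (continuous_sqrt.tendsto 0).comp h1
  rw [sqrt_zero] at h2
  exact (tendsto_zero_iff_abs_tendsto_zero f).2 (h2.congr fun t => sqrt_sq_eq_abs (f t))

theorem abs_dotProduct_le (w u : Conf) : |w ⬝ᵥ u| ≤ 5 * ‖w‖ * ‖u‖ := by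
  calc |w ⬝ᵥ u| ≤ ∑ i, |w i * u i| := Finset.abs_sum_le_sum_abs _ _
    _ ≤ ∑ _i : Fin 5, ‖w‖ * ‖u‖ := by
        refine Finset.sum_le_sum fun i _ => ?_
        rw [abs_mul]
        exact mul_le_mul (norm_le_pi_norm w i) (norm_le_pi_norm u i) (abs_nonneg _) (norm_nonneg _)
    _ = 5 * ‖w‖ * ‖u‖ := by simp; ring

theorem tendsto_bounded_mul {b f : ℝ → ℝ} {B : ℝ} (hb : ∀ t ≥ 0, |b t| ≤ B)
    (hf : Tendsto f atTop (𝓝 0)) : Tendsto (fun t => b t * f t) atTop (𝓝 0) := by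
  refine squeeze_zero_norm' (a := fun t => B * |f t|) ?_ (by simpa using hf.abs.const_mul B)
  filter_upwards [eventually_ge_atTop 0] with t ht
  rw [Real.norm_eq_abs, abs_mul]
  exact mul_le_mul_of_nonneg_right (hb t ht) (abs_nonneg _)

theorem exists_bound_of_continuousOn {X E : Type*} [TopologicalSpace X] [NormedAddCommGroup E]
    {K : Set X} (hK : IsCompact K) {F : X → E} (hF : ContinuousOn F K) :
    ∃ B, 0 ≤ B ∧ ∀ x ∈ K, ‖F x‖ ≤ B := by
  obtain ⟨B, hB⟩ := hK.exists_bound_of_continuousOn hF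
  exact ⟨max B 0, le_max_right _ _, fun x hx => (hB x hx).trans (le_max_left _ _)⟩

/-- Data of a motion on `[0, ∞)` that stays in a compact region inside the barrier on which the
inertia matrix is nonsingular. -/
structure StaysIn (k : Gains) (d : Target p) (K : Set Conf) (q v : ℝ → Conf) : Prop where
  motion : IsMotion k d (Ici 0) q v
  compact : IsCompact K
  mem : ∀ t ≥ 0, q t ∈ K
  inside : ∀ x ∈ K, ey d x ^ 2 < k.ρ
  nonsing : ∀ x ∈ K, 0 < max (cos (x 2 - x 4)) (cos (x 3 + x 4))

namespace StaysIn

variable {K : Set Conf} {q v : ℝ → Conf}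

theorem energy_le (h : StaysIn k d K q v) {t : ℝ} (ht : 0 ≤ t) :
    energy k d (q t) (v t) ≤ energy k d (q 0) (v 0) :=
  ((h.motion.mono (Ico_subset_Ici_self : Ico 0 (t + 1) ⊆ Ici 0)).energy_le
    (h.inside _ (h.mem 0 le_rfl)) ⟨ht, by linarith⟩).2

theorem exists_vel_bound (h : StaysIn k d K q v) : ∃ R, 0 ≤ R ∧ ∀ t ≥ 0, ‖v t‖ ≤ R := by
  obtain ⟨c, hc, hcK⟩ := exists_kinetic_lower_bound p h.compact h.nonsing
  refine ⟨sqrt (2 * energy k d (q 0) (v 0) / c), sqrt_nonneg _, fun t ht => ?_⟩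
  refine le_sqrt_of_sq_le ?_
  rw [le_div_iff₀' hc]
  exact (hcK _ (h.mem t ht) (v t)).trans
    (energy_bounds (h.inside _ (h.mem t ht)) (h.energy_le ht)).1

theorem exists_phase_compact (h : StaysIn k d K q v) :
    ∃ C : Set (Conf × Conf), IsCompact C ∧ (∀ x ∈ C, x.1 ∈ K) ∧
      ∀ t ≥ 0, (q t, v t) ∈ C := by
  obtain ⟨R, -, hR⟩ := h.exists_vel_bound
  exact ⟨K ×ˢ Metric.closedBall 0 R, h.compact.prod (isCompact_closedBall 0 R),
    fun x hx => hx.1,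
    fun t ht => ⟨h.mem t ht, mem_closedBall_zero_iff.2 (hR t ht)⟩⟩

theorem totalForce_continuousOn (h : StaysIn k d K q v) {C : Set (Conf × Conf)}
    (hC : ∀ x ∈ C, x.1 ∈ K) : ContinuousOn (fun x => totalForce k d x.1 x.2) C :=
  (DroneBar.totalForce_continuousOn k d).mono fun x hx => h.inside _ (hC x hx)

/-- `M(q) w = F - Ṁ v` is bounded along the motion, and coercivity of `M` bounds `w` without
inverting the matrix. The factor 5 comes from the sup norm on `Fin 5 → ℝ`. -/
theorem exists_accel_bound (h : StaysIn k d K q v) :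
    ∃ W, 0 ≤ W ∧ ∀ t ≥ 0, ‖derivWithin v (Ici 0) t‖ ≤ W := by
  obtain ⟨C, hC, hCK, hx⟩ := h.exists_phase_compact
  obtain ⟨c, hc, hcK⟩ := exists_kinetic_lower_bound p h.compact h.nonsing
  obtain ⟨B, hB0, hB⟩ := exists_bound_of_continuousOn hC
    (F := fun x => totalForce k d x.1 x.2 - (inertiaRate p x.1 x.2).mulVec x.2)
    ((h.totalForce_continuousOn hCK).sub (inertiaRate_mulVec_continuous p).continuousOn)
  refine ⟨5 * B / c, by positivity, fun t ht => ?_⟩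
  have hw := (h.motion.diff_v t ht).hasDerivWithinAt
  set w := derivWithin v (Ici 0) t
  have h1 : momentum p (q t) w
      = totalForce k d (q t) (v t) - (inertiaRate p (q t) (v t)).mulVec (v t) := by
    ext i
    have := h.motion.accel_eq ht (uniqueDiffOn_Ici 0 t ht) hw i
    simp only [Pi.sub_apply]; linarith
  have h3 : ‖momentum p (q t) w‖ ≤ B := by
    rw [h1]; exact hB (q t, v t) (hx t ht)
  have h2 : c * ‖w‖ ^ 2 ≤ 5 * ‖w‖ * B := by
    calc c * ‖w‖ ^ 2 ≤ w ⬝ᵥ momentum p (q t) w := hcK _ (h.mem t ht) w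
      _ ≤ 5 * ‖w‖ * ‖momentum p (q t) w‖ := (le_abs_self _).trans (abs_dotProduct_le _ _)
      _ ≤ 5 * ‖w‖ * B := mul_le_mul_of_nonneg_left h3 (by positivity)
  rw [le_div_iff₀ hc]
  rcases (norm_nonneg w).eq_or_lt with h0 | h0
  · rw [← h0]; simpa using hB0
  · refine le_of_mul_le_mul_left ?_ h0
    linarith

theorem uniformContinuousOn_phase (h : StaysIn k d K q v) :
    UniformContinuousOn (fun t => (q t, v t)) (Ici 0) := by
  obtain ⟨R, hR0, hR⟩ := h.exists_vel_bound
  obtain ⟨W, hW0, hW⟩ := h.exists_accel_bound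
  have h1 := (convex_Ici (0 : ℝ)).lipschitzOnWith_of_nnnorm_hasDerivWithin_le (C := ⟨R, hR0⟩)
    h.motion.deriv_q (fun t ht => hR t ht)
  have h2 := (convex_Ici (0 : ℝ)).lipschitzOnWith_of_nnnorm_hasDerivWithin_le (C := ⟨W, hW0⟩)
    (fun t ht => (h.motion.diff_v t ht).hasDerivWithinAt) (fun t ht => hW t ht)
  exact (h1.prodMk h2).uniformContinuousOn

theorem dissipation_tendsto (h : StaysIn k d K q v) :
    Tendsto (fun t => dissipation p k (q t) (v t)) atTop (𝓝 0) := by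
  obtain ⟨C, hC, -, hx⟩ := h.exists_phase_compact
  have hu : UniformContinuousOn (fun t => dissipation p k (q t) (v t)) (Ici 0) :=
    UniformContinuousOn.comp (g := fun x : Conf × Conf => dissipation p k x.1 x.2)
      (f := fun t => (q t, v t))
      (hC.uniformContinuousOn_of_continuous (dissipation_continuous p k).continuousOn)
      h.uniformContinuousOn_phase fun t ht => hx t ht
  have hE : ∀ t ≥ 0, 0 ≤ energy k d (q t) (v t) := fun t ht => by
    have h1 := (energy_bounds (v := v t) (h.inside _ (h.mem t ht)) le_rfl).1
    have h2 := dotProduct_momentum_nonneg p (q t) (v t)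
    linarith
  exact tendsto_zero_of_antitone
    (fun t ht => h.motion.hasDerivWithinAt_energy ht (uniqueDiffOn_Ici 0 t ht)
      (h.inside _ (h.mem t ht))) hE (fun t _ => dissipation_nonneg p k (q t) (v t)) hu

theorem drone_vel_tendsto (h : StaysIn k d K q v) :
    Tendsto (fun t => v t 0) atTop (𝓝 0) ∧ Tendsto (fun t => v t 1) atTop (𝓝 0) ∧
    Tendsto (fun t => y2dot p (q t) (v t)) atTop (𝓝 0) ∧
    Tendsto (fun t => z2dot p (q t) (v t)) atTop (𝓝 0) := by
  have hD := h.dissipation_tendsto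
  have bounds : ∀ t, k.kd1 * v t 0 ^ 2 ≤ dissipation p k (q t) (v t) ∧
      k.kd3 * v t 1 ^ 2 ≤ dissipation p k (q t) (v t) ∧
      k.kd2 * y2dot p (q t) (v t) ^ 2 ≤ dissipation p k (q t) (v t) ∧
      k.kd4 * z2dot p (q t) (v t) ^ 2 ≤ dissipation p k (q t) (v t) := by
    intro t
    have a1 := mul_nonneg k.kd1_pos.le (sq_nonneg (v t 0))
    have a2 := mul_nonneg k.kd2_pos.le (sq_nonneg (y2dot p (q t) (v t)))
    have a3 := mul_nonneg k.kd3_pos.le (sq_nonneg (v t 1))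
    have a4 := mul_nonneg k.kd4_pos.le (sq_nonneg (z2dot p (q t) (v t)))
    have a5 := mul_nonneg (mul_nonneg k.ka1_pos.le (swingSq_nonneg (v t))) (sq_nonneg (v t 0))
    have a6 := mul_nonneg (mul_nonneg k.ka2_pos.le (swingSq_nonneg (v t)))
      (sq_nonneg (y2dot p (q t) (v t)))
    simp only [dissipation, y1dot, z1dot]
    refine ⟨?_, ?_, ?_, ?_⟩ <;> linarith
  exact ⟨tendsto_zero_of_mul_sq_le k.kd1_pos (fun t => (bounds t).1) hD,
    tendsto_zero_of_mul_sq_le k.kd3_pos (fun t => (bounds t).2.1) hD,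
    tendsto_zero_of_mul_sq_le k.kd2_pos (fun t => (bounds t).2.2.1) hD,
    tendsto_zero_of_mul_sq_le k.kd4_pos (fun t => (bounds t).2.2.2) hD⟩

/-- A slowly varying total force tends to zero. -/
theorem totalForce_tendsto (h : StaysIn k d K q v) {i : Fin 5}
    (hs : SlowlyVarying fun t => totalForce k d (q t) (v t) i) :
    Tendsto (fun t => totalForce k d (q t) (v t) i) atTop (𝓝 0) := by
  obtain ⟨C, hC, -, hx⟩ := h.exists_phase_compact
  obtain ⟨B, -, hB⟩ := exists_bound_of_continuousOn hC (momentum_continuous p).continuousOn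
  have hB' : ∀ t ≥ 0, |momentum p (q t) (v t) i| ≤ B := fun t ht => by
    rw [← Real.norm_eq_abs]
    exact (norm_le_pi_norm (momentum p (q t) (v t)) i).trans (hB (q t, v t) (hx t ht))
  exact hs.tendsto_zero (fun t ht => h.motion.hasDerivWithinAt_momentum ht i) hB'

/-- If the `i`-th total force tends to zero and the `i`-th momentum is the rate of change of a
function of the configuration, then the `i`-th momentum tends to zero. -/
theorem momentum_tendsto (h : StaysIn k d K q v) {i : Fin 5}
    (hs : Tendsto (fun t => totalForce k d (q t) (v t) i) atTop (𝓝 0)) {Y : Conf → ℝ}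
    (hY : Continuous Y) (hY' : ∀ t ∈ Ici (0 : ℝ),
      HasDerivWithinAt (fun t => Y (q t)) (momentum p (q t) (v t) i) (Ici 0) t) :
    Tendsto (fun t => momentum p (q t) (v t) i) atTop (𝓝 0) := by
  obtain ⟨B, -, hB⟩ := exists_bound_of_continuousOn h.compact hY.continuousOn
  exact (SlowlyVarying.of_deriv (fun t ht => h.motion.hasDerivWithinAt_momentum ht i)
    hs).tendsto_zero hY' fun t ht => hB _ (h.mem t ht)

/-- In the total horizontal force the barrier terms cancel. The damping tends to zero, since
`swingSq` stays bounded, and the rates of the position errors are the vanishing drone velocities; so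
the force varies slowly. The momentum is the rate of `m₁ y₁ + m₂ y₂ + m₃ y₃` up to constants, which
is the bounded function `Y`. -/
theorem momentum_zero_tendsto (h : StaysIn k d K q v) :
    Tendsto (fun t => momentum p (q t) (v t) 0) atTop (𝓝 0) := by
  obtain ⟨l1, -, l2, -⟩ := h.drone_vel_tendsto
  obtain ⟨R, hR0, hR⟩ := h.exists_vel_bound
  have hsw : ∀ {kd ka : ℝ}, 0 < kd → 0 < ka → ∀ t ≥ 0,
      |kd + ka * swingSq (v t)| ≤ kd + ka * (3 * R ^ 2) := by
    intro kd ka h1 h2 t ht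
    have h3 : ∀ i, v t i ^ 2 ≤ R ^ 2 := fun i =>
      sq_le_sq.2 (((norm_le_pi_norm (v t) i).trans (hR t ht)).trans (le_abs_self R))
    have h4 : swingSq (v t) ≤ 3 * R ^ 2 := by
      unfold swingSq; linarith [h3 2, h3 3, h3 4]
    have h5 := mul_nonneg h2.le (swingSq_nonneg (v t))
    rw [abs_of_nonneg (by linarith)]
    linarith [mul_le_mul_of_nonneg_left h4 h2.le]
  have hsv : SlowlyVarying fun t => totalForce k d (q t) (v t) 0 := by
    have s1 : SlowlyVarying fun t => -(k.kp1 * ey1 d (q t) + k.kp2 * ey2 d (q t)) :=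
      SlowlyVarying.of_deriv (fun t ht =>
        let e := hasDerivWithinAt_ey (d := d) (h.motion.deriv_q t ht)
        ((e.1.const_mul k.kp1).add (e.2.2.1.const_mul k.kp2)).neg)
        (by simpa using ((l1.const_mul k.kp1).add (l2.const_mul k.kp2)).neg)
    have s2 := SlowlyVarying.of_tendsto
      ((tendsto_bounded_mul (hsw k.kd1_pos k.ka1_pos) l1).add
        (tendsto_bounded_mul (hsw k.kd2_pos k.ka2_pos) l2)).neg
    refine (congrArg SlowlyVarying (funext fun t => ?_)).mp (s1.add s2)
    simp [totalForce, lagrangianGrad, genForce, u1s, u2s, theta2d, y1dot]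
    ring
  refine h.momentum_tendsto (h.totalForce_tendsto hsv)
    (Y := fun q => p.m1 * q 0 + p.m2 * ey2 d q + p.m3 * (q 0 + p.l * sin (q 2)
      + p.a / 2 * cos (q 4))) ?_ fun t ht => ?_
  · unfold ey2 y2; fun_prop
  · have hq := hasDerivWithinAt_pi.1 (h.motion.deriv_q t ht)
    have e := hasDerivWithinAt_ey (d := d) (h.motion.deriv_q t ht)
    refine ((((hq 0).const_mul p.m1).add (e.2.2.1.const_mul p.m2)).add
      ((((hq 0).add ((hq 2).sin.const_mul p.l)).add
        ((hq 4).cos.const_mul (p.a / 2))).const_mul p.m3)).congr_deriv ?_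
    simp [momentum_apply, Fin.sum_univ_five, inertia, y2dot]
    ring

theorem momentum_one_tendsto (h : StaysIn k d K q v) :
    Tendsto (fun t => momentum p (q t) (v t) 1) atTop (𝓝 0) := by
  obtain ⟨-, l1, -, l2⟩ := h.drone_vel_tendsto
  have hsv : SlowlyVarying fun t => totalForce k d (q t) (v t) 1 := by
    have s1 : SlowlyVarying fun t => -(k.kp3 * ez1 d (q t) + k.kp4 * ez2 d (q t)) :=
      SlowlyVarying.of_deriv (fun t ht =>
        let e := hasDerivWithinAt_ey (d := d) (h.motion.deriv_q t ht)
        ((e.2.1.const_mul k.kp3).add (e.2.2.2.const_mul k.kp4)).neg)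
        (by simpa using ((l1.const_mul k.kp3).add (l2.const_mul k.kp4)).neg)
    have s2 := SlowlyVarying.of_tendsto ((l1.const_mul k.kd3).add (l2.const_mul k.kd4)).neg
    refine (congrArg SlowlyVarying (funext fun t => ?_)).mp (s1.add s2)
    simp [totalForce, lagrangianGrad, genForce, u1c, u2c, z1dot]
    ring
  refine h.momentum_tendsto (h.totalForce_tendsto hsv)
    (Y := fun q => p.m1 * q 1 + p.m2 * ez2 d q + p.m3 * (q 1 - p.l * cos (q 2)
      + p.a / 2 * sin (q 4))) ?_ fun t ht => ?_
  · unfold ez2 z2; fun_prop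
  · have hq := hasDerivWithinAt_pi.1 (h.motion.deriv_q t ht)
    have e := hasDerivWithinAt_ey (d := d) (h.motion.deriv_q t ht)
    refine ((((hq 1).const_mul p.m1).add (e.2.2.2.const_mul p.m2)).add
      ((((hq 1).sub ((hq 2).cos.const_mul p.l)).add
        ((hq 4).sin.const_mul (p.a / 2))).const_mul p.m3)).congr_deriv ?_
    simp [momentum_apply, Fin.sum_univ_five, inertia, z2dot]
    ring

theorem vel_tendsto (h : StaysIn k d K q v) : Tendsto v atTop (𝓝 0) := by
  obtain ⟨l1, l2, l3, l4⟩ := h.drone_vel_tendsto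
  have l5 : Tendsto (fun t => y3dot p (q t) (v t)) atTop (𝓝 0) := by
    have := ((h.momentum_zero_tendsto.sub (l1.const_mul p.m1)).sub
      (l3.const_mul p.m2)).const_mul p.m3⁻¹
    simp only [mul_zero, sub_zero] at this
    refine this.congr fun t => ?_
    rw [inv_mul_eq_iff_eq_mul₀ p.m3_pos.ne']
    simp [momentum_apply, Fin.sum_univ_five, inertia, y2dot, y3dot]
    ring
  have l6 : Tendsto (fun t => z3dot p (q t) (v t)) atTop (𝓝 0) := by
    have := ((h.momentum_one_tendsto.sub (l2.const_mul p.m1)).sub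
      (l4.const_mul p.m2)).const_mul p.m3⁻¹
    simp only [mul_zero, sub_zero] at this
    refine this.congr fun t => ?_
    rw [inv_mul_eq_iff_eq_mul₀ p.m3_pos.ne']
    simp [momentum_apply, Fin.sum_univ_five, inertia, z2dot, z3dot]
    ring
  have hK : Tendsto (fun t => v t ⬝ᵥ momentum p (q t) (v t)) atTop (𝓝 0) := by
    have := (((((l1.pow 2).add (l2.pow 2)).const_mul p.m1).add
      (((l3.pow 2).add (l4.pow 2)).const_mul p.m2))).add
      (((l5.pow 2).add (l6.pow 2)).const_mul p.m3)
    simp only [ne_eq, OfNat.ofNat_ne_zero, not_false_eq_true, zero_pow, add_zero, mul_zero]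
      at this
    exact this.congr fun t => (dotProduct_momentum p (q t) (v t)).symm
  obtain ⟨c, hc, hcK⟩ := exists_kinetic_lower_bound p h.compact h.nonsing
  rw [tendsto_zero_iff_norm_tendsto_zero]
  -- Coercivity is known for `t ≥ 0` only, while `tendsto_zero_of_mul_sq_le` asks for all `t`; hence
  -- `max t 0`.
  have hK' : Tendsto (fun t => v (max t 0) ⬝ᵥ momentum p (q (max t 0)) (v (max t 0)))
      atTop (𝓝 0) := by
    refine hK.congr' ?_
    filter_upwards [eventually_ge_atTop 0] with t ht
    rw [max_eq_left ht]
  have := tendsto_zero_of_mul_sq_le (f := fun t => ‖v (max t 0)‖) hc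
    (fun t => hcK _ (h.mem _ (le_max_right t 0)) _) hK'
  refine this.congr' ?_
  filter_upwards [eventually_ge_atTop 0] with t ht
  rw [max_eq_left ht]

theorem conf_tendsto (h : StaysIn k d K q v)
    (hrest : ∀ x ∈ K, (∀ i, totalForce k d x 0 i = 0) → x = qd d) :
    Tendsto q atTop (𝓝 (qd d)) := by
  obtain ⟨C, hC, hCK, hx⟩ := h.exists_phase_compact
  have hv := h.vel_tendsto
  have hFC := h.totalForce_continuousOn hCK
  have hsx : SlowlyVarying fun t => (q t, v t) :=
    (SlowlyVarying.of_deriv h.motion.deriv_q hv).prodMk (SlowlyVarying.of_tendsto hv)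
  have hF : Tendsto (fun t => totalForce k d (q t) (v t)) atTop (𝓝 0) := by
    refine tendsto_pi_nhds.2 fun i => h.totalForce_tendsto ?_
    exact SlowlyVarying.comp_continuousOn (g := fun t => (q t, v t)) hsx hC
      (F := fun x => totalForce k d x.1 x.2 i) (continuousOn_pi.1 hFC i) hx
  refine h.compact.tendsto_nhds_of_unique_mapClusterPt
    ((eventually_ge_atTop 0).mono h.mem) fun x hxK hcl => hrest x hxK fun i => ?_
  obtain ⟨φ, hφq, hφ⟩ := hcl.exists_seq_tendsto
  have hopen : IsOpen {x : Conf × Conf | ey d x.1 ^ 2 < k.ρ} :=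
    isOpen_lt ((continuous_ey.comp continuous_fst).pow 2) continuous_const
  have hcont : ContinuousAt (fun x : Conf × Conf => totalForce k d x.1 x.2) (x, 0) :=
    (DroneBar.totalForce_continuousOn k d).continuousAt (hopen.mem_nhds (h.inside x hxK))
  have hlim : Tendsto (fun n => totalForce k d (q (φ n)) (v (φ n))) atTop
      (𝓝 (totalForce k d x 0)) :=
    Tendsto.comp (f := fun n => (q (φ n), v (φ n)))
      (g := fun x : Conf × Conf => totalForce k d x.1 x.2) hcont
      (hφq.prodMk_nhds (hv.comp hφ))
  exact congrFun (tendsto_nhds_unique hlim (hF.comp hφ)) i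

end StaysIn


/-! ### The target state -/

@[simp] theorem ey1_qd (d : Target p) : ey1 d (qd d) = 0 := by simp [ey1, y1, qd]

@[simp] theorem ez1_qd (d : Target p) : ez1 d (qd d) = 0 := by simp [ez1, z1, qd]

@[simp] theorem ey2_qd (d : Target p) : ey2 d (qd d) = 0 := by
  have := d.y_rel
  simp [ey2, y2, qd]; linarith

@[simp] theorem ez2_qd (d : Target p) : ez2 d (qd d) = 0 := by
  have := d.z_rel
  simp [ez2, z2, qd]; linarith

@[simp] theorem ey_qd (d : Target p) : ey d (qd d) = 0 := by simp [ey]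

theorem totalForce_qd (k : Gains) (d : Target p) (i : Fin 5) : totalForce k d (qd d) 0 i = 0 := by
  fin_cases i <;>
    simp [totalForce, lagrangianGrad, genForce, u1s, u1c, u2s, u2c, theta2d, y1dot, z1dot, y2dot,
      z2dot, barrier, show qd d 2 = 0 from rfl, show qd d 3 = 0 from rfl,
      show qd d 4 = 0 from rfl] <;> ring

theorem isEquilibrium (k : Gains) (d : Target p) : IsEquilibrium k d where
  deriv_q t _ := hasDerivWithinAt_const t univ (qd d)
  diff_v := differentiableOn_const 0
  euler_lagrange t _ i := by
    have h := totalForce_qd k d i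
    rw [totalForce, ← dLdq_eq] at h
    rw [h]
    exact hasDerivWithinAt_const t univ _

theorem converges_of_tendsto {q v : ℝ → Conf} (hq : Tendsto q atTop (𝓝 (qd d)))
    (hv : Tendsto v atTop (𝓝 0)) : Converges d q v := by
  have h := tendsto_pi_nhds.1 hq
  have comp {F : Conf → ℝ} (hF : Continuous F) (h0 : F (qd d) = 0) :
      Tendsto (fun t => F (q t)) atTop (𝓝 0) := by
    have := (hF.tendsto (qd d)).comp hq
    rwa [h0] at this
  refine ⟨comp ?_ (ey1_qd d), comp ?_ (ez1_qd d), comp ?_ (ey2_qd d), comp ?_ (ez2_qd d),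
    comp (continuous_apply 2) rfl, comp (continuous_apply 3) rfl, comp (continuous_apply 4) rfl, hv⟩
  · unfold ey1 y1; fun_prop
  · unfold ez1 z1; fun_prop
  · unfold ey2 y2; fun_prop
  · unfold ez2 z2; fun_prop

/-! ### Convergence under the angle assumption -/

theorem abs_le_of_mul_sq_le {c x E : ℝ} (hc : 0 < c) (h : c * x ^ 2 ≤ E) : |x| ≤ sqrt (E / c) :=
  abs_le_sqrt ((le_div_iff₀' hc).2 h)

/-- The closed admissible region of configurations with energy at most `E`. -/
noncomputable def region (k : Gains) (d : Target p) (E ε : ℝ) : Set Conf :=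
  Icc ![d.y1d - sqrt (2 * E / k.kp1), d.z1d - sqrt (2 * E / k.kp3), -(π / 2), -(π / 2), -(π / 2)]
      ![d.y1d + sqrt (2 * E / k.kp1), d.z1d + sqrt (2 * E / k.kp3), π / 2, π / 2, π / 2] ∩
    {x | 0 ≤ cos (x 2 - x 4) ∧ 0 ≤ cos (x 3 + x 4) ∧
      ε ≤ max (cos (x 2 - x 4)) (cos (x 3 + x 4)) ∧
      k.σ * ey d x ^ 2 ≤ 2 * E * (k.ρ - ey d x ^ 2)}

theorem isCompact_region (k : Gains) (d : Target p) (E ε : ℝ) : IsCompact (region k d E ε) := by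
  have h := continuous_ey (d := d)
  refine isCompact_Icc.inter_right (IsClosed.and (isClosed_le ?_ ?_) (IsClosed.and
    (isClosed_le ?_ ?_) (IsClosed.and (isClosed_le ?_ ?_) (isClosed_le ?_ ?_)))) <;> fun_prop

/-- The strict angle conditions may be lost in the closure, so the rest point lemma admits boundary
values; the uniform `ε` survives and keeps `M` nonsingular on the compact region. -/
theorem converges_of_angleAssumption {q v : ℝ → Conf} (h : IsMotion k d (Ici 0) q v)
    (hang : AngleAssumption q) (h0 : ey d (q 0) ^ 2 < k.ρ) : Converges d q v := by
  obtain ⟨ε, hε, hmax⟩ := hang.nondeg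
  set E := energy k d (q 0) (v 0)
  have hbound : ∀ t ≥ 0, ey d (q t) ^ 2 < k.ρ ∧ energy k d (q t) (v t) ≤ E := fun t ht =>
    (h.mono (Ico_subset_Ici_self : Ico 0 (t + 1) ⊆ Ici 0)).energy_le h0 ⟨ht, by linarith⟩
  have hE : 0 ≤ 2 * E :=
    (dotProduct_momentum_nonneg p (q 0) (v 0)).trans (energy_bounds h0 le_rfl).1
  have hstay : StaysIn k d (region k d E ε) q v := by
    refine ⟨h, isCompact_region k d E ε, fun t ht => ⟨?_, (hang.cable1 t ht).le,
      (hang.cable2 t ht).le, hmax t ht, ?_⟩, fun x hx => ?_, fun x hx => hε.trans_le hx.2.2.2.1⟩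
    · obtain ⟨-, b1, -, b3, -⟩ := energy_bounds (hbound t ht).1 (hbound t ht).2
      have c1 := abs_le.1 (abs_le_of_mul_sq_le k.kp1_pos b1)
      have c3 := abs_le.1 (abs_le_of_mul_sq_le k.kp3_pos b3)
      simp only [ey1, y1, ez1, z1] at c1 c3
      have a2 := hang.th1 t ht
      have a3 := hang.th2 t ht
      have a4 := hang.th3 t ht
      constructor <;> intro i <;> fin_cases i <;> simp <;> linarith
    · exact (energy_bounds (hbound t ht).1 (hbound t ht).2).2.2.2.2.2.2.2
    · by_contra! hcon
      have h1 := hx.2.2.2.2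
      have h2 := mul_nonneg hE (sub_nonneg.2 hcon)
      have h3 := mul_le_mul_of_nonneg_left hcon k.σ_pos.le
      have h4 := mul_pos k.σ_pos k.ρ_pos
      linarith
  refine converges_of_tendsto (hstay.conf_tendsto fun x hx hF => ?_) hstay.vel_tendsto
  obtain ⟨⟨hlo, hhi⟩, hC1, hC2, hC, -⟩ := hx
  exact eq_qd_of_totalForce_eq_zero ⟨hlo 2, hhi 2⟩ ⟨hlo 3, hhi 3⟩ ⟨hlo 4, hhi 4⟩ hC1 hC2
    (hε.trans_le hC) hF

/-! ### Lyapunov stability and local attractivity -/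

/-- Zero energy makes every term vanish. The bar angle does not occur in the potential by itself; it
is recovered from the height difference of the drones. -/
theorem energy_pos {q v : Conf} (hρ : ey d q ^ 2 < k.ρ) (h2 : q 2 ∈ Icc (-(π / 2)) (π / 2))
    (h3 : q 3 ∈ Icc (-(π / 2)) (π / 2)) (h4 : q 4 ∈ Icc (-(π / 2)) (π / 2))
    (hne : (q, v) ≠ (qd d, 0)) : 0 < energy k d q v := by
  by_contra! hE
  obtain ⟨b0, b1, -, b3, b4, b5, b6, -⟩ := energy_bounds hρ hE
  have sq0 {c x : ℝ} (hc : 0 < c) (h : c * x ^ 2 ≤ 2 * 0) : x = 0 := by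
    have h1 : x ^ 2 ≤ 0 := by
      by_contra! h2; linarith [mul_pos hc h2]
    exact pow_eq_zero_iff two_ne_zero |>.1 (le_antisymm h1 (sq_nonneg x))
  have hm : 0 < p.m3 * p.g * p.l := mul_pos (mul_pos p.m3_pos p.g_pos) p.l_pos
  have cos1 {x : ℝ} (h : p.m3 * p.g * p.l * (1 - cos x) ≤ 2 * 0) : cos x = 1 := by
    refine le_antisymm (cos_le_one x) ?_
    by_contra! h1; linarith [mul_pos hm (sub_pos.2 h1)]
  have sin0 {x : ℝ} (h : cos x = 1) : sin x = 0 := by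
    have := sin_sq_add_cos_sq x
    rw [h] at this
    exact pow_eq_zero_iff two_ne_zero |>.1 (by linarith)
  have e1 := sq0 k.kp1_pos b1
  have e3 := sq0 k.kp3_pos b3
  have e4 := sq0 k.kp4_pos b4
  have c2 := cos1 b5
  have c3 := cos1 b6
  have s4 : sin (q 4) = 0 := by
    have := ez2_sub_ez1 d q
    rw [e3, e4, c2, c3] at this
    have : p.a * sin (q 4) = 0 := by linarith
    exact (mul_eq_zero.1 this).resolve_left p.a_pos.ne'
  have hq := eq_qd h2 h3 h4 e1 e3 (sin0 c2) (sin0 c3) s4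
  refine hne (Prod.ext hq ?_)
  by_contra hv
  have := dotProduct_momentum_pos (p := p) (q := q) (v := v) (by rw [hq]; simp [qd]) hv
  linarith

theorem energy_qd (k : Gains) (d : Target p) : energy k d (qd d) 0 = 0 := by
  simp [energy, potential]
  simp [qd]
  ring_nf
  simp

theorem energy_continuousOn (k : Gains) (d : Target p) :
    ContinuousOn (fun x : Conf × Conf => energy k d x.1 x.2) {x | ey d x.1 ^ 2 < k.ρ} := by
  have hc : Continuous fun x : Conf × Conf => ey d x.1 := continuous_ey.comp continuous_fst
  have hb : ContinuousOn (fun x : Conf × Conf => ey d x.1 ^ 2 / (k.ρ - ey d x.1 ^ 2))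
      {x | ey d x.1 ^ 2 < k.ρ} :=
    (hc.pow 2).continuousOn.div (continuous_const.sub (hc.pow 2)).continuousOn fun x hx =>
      (sub_pos.2 hx).ne'
  have hk := (kinetic_continuous p).continuousOn (s := {x | ey d x.1 ^ 2 < k.ρ})
  have hq : Continuous fun x : Conf × Conf =>
      1 / 2 * (k.kp1 * ey1 d x.1 ^ 2 + k.kp2 * ey2 d x.1 ^ 2 + k.kp3 * ez1 d x.1 ^ 2
        + k.kp4 * ez2 d x.1 ^ 2) + p.m3 * p.g * p.l / 2 * (2 - cos (x.1 2) - cos (x.1 3)) := by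
    simp only [ey1, ey2, ez1, ez2, y1, y2, z1, z2]
    fun_prop
  exact (continuousOn_const.mul hk).add (hq.continuousOn.add (continuousOn_const.mul hb))

theorem isOpen_inside (k : Gains) (d : Target p) : IsOpen {x : Conf × Conf | ey d x.1 ^ 2 < k.ρ} :=
  isOpen_lt ((continuous_ey.comp continuous_fst).pow 2) continuous_const

theorem inside_mem_nhds (k : Gains) (d : Target p) :
    {x : Conf × Conf | ey d x.1 ^ 2 < k.ρ} ∈ 𝓝 (qd d, (0 : Conf)) :=
  (isOpen_inside k d).mem_nhds (by simp [k.ρ_pos])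

theorem abs_angle_le {x : Conf × Conf} {r : ℝ} (h : dist x (qd d, 0) ≤ r) {i : Fin 5}
    (hi : qd d i = 0) : |x.1 i| ≤ r := by
  have h1 : dist (x.1 i) (qd d i) ≤ r :=
    (dist_le_pi_dist x.1 (qd d) i).trans ((le_max_left _ _).trans h)
  rwa [hi, Real.dist_eq, sub_zero] at h1

theorem isLyapunovStable (k : Gains) (d : Target p) : IsLyapunovStable k d := by
  intro ε hε
  obtain ⟨r₀, hr₀, hball⟩ := Metric.mem_nhds_iff.1 (inside_mem_nhds k d)
  set x₀ : Conf × Conf := (qd d, 0)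
  -- On the ball of radius `r` the angles are at most `1 < π / 2` and the barrier is respected, so
  -- the energy is positive on its sphere.
  obtain ⟨r, hr, hrε, hr1, hrr₀⟩ : ∃ r > 0, r < ε ∧ r ≤ 1 ∧ r < r₀ :=
    ⟨min (ε / 2) (min 1 (r₀ / 2)), by positivity,
      (min_le_left _ _).trans_lt (half_lt_self hε),
      (min_le_right _ _).trans (min_le_left _ _),
      ((min_le_right _ _).trans (min_le_right _ _)).trans_lt (half_lt_self hr₀)⟩
  have hin : Metric.closedBall x₀ r ⊆ {x | ey d x.1 ^ 2 < k.ρ} := fun x hx =>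
    hball (lt_of_le_of_lt hx hrr₀)
  have hang : ∀ x ∈ Metric.closedBall x₀ r, ∀ i : Fin 5, qd d i = 0 →
      x.1 i ∈ Icc (-(π / 2)) (π / 2) := fun x hx i hi => by
    have h1 := abs_le.1 (abs_angle_le hx hi)
    have h2 := pi_gt_three
    constructor <;> linarith [h1.1, h1.2]
  obtain ⟨x, hx, hmin⟩ := (isCompact_sphere x₀ r).exists_isMinOn
    (NormedSpace.sphere_nonempty.2 hr.le)
    ((energy_continuousOn k d).mono (Metric.sphere_subset_closedBall.trans hin))
  have hxc := Metric.sphere_subset_closedBall hx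
  have hm : 0 < energy k d x.1 x.2 := by
    refine energy_pos (hin hxc) (hang x hxc 2 rfl) (hang x hxc 3 rfl) (hang x hxc 4 rfl) ?_
    rintro h
    have : dist x x₀ = 0 := dist_eq_zero.2 h
    rw [Metric.mem_sphere.1 hx] at this
    exact hr.ne' this
  have hcont := (energy_continuousOn k d).continuousAt (inside_mem_nhds k d)
  have hsmall : ∀ᶠ y in 𝓝 x₀, energy k d y.1 y.2 < energy k d x.1 x.2 := by
    refine hcont.eventually_lt_const ?_
    simpa only [energy_qd] using hm
  obtain ⟨δ, hδ, hδ'⟩ := Metric.eventually_nhds_iff.1 hsmall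
  refine ⟨min δ r, lt_min hδ hr, fun τ q v h h0 t ht => ?_⟩
  have hq0 := hin (le_of_lt (h0.trans_le (min_le_right _ _)) : (q 0, v 0) ∈ Metric.closedBall x₀ r)
  have hlow := hδ' (h0.trans_le (min_le_left _ _))
  by_contra! hcon
  have hsub : Icc 0 t ⊆ Ico 0 τ := fun s hs => ⟨hs.1, hs.2.trans_lt ht.2⟩
  have hc : ContinuousOn (fun s => dist (q s, v s) x₀) (Icc 0 t) := by
    have h1 : ContinuousOn q (Icc 0 t) := fun s hs =>
      (h.deriv_q s (hsub hs)).continuousWithinAt.mono hsub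
    have h2 : ContinuousOn v (Icc 0 t) := h.diff_v.continuousOn.mono hsub
    exact (continuous_id.dist continuous_const).comp_continuousOn (h1.prodMk h2)
  -- A motion that left the `ε`-ball would cross this sphere, where the energy is at least its
  -- minimum there and hence above the initial energy.
  obtain ⟨s, hs, hsr⟩ := intermediate_value_Icc ht.1 hc
    ⟨(h0.trans_le (min_le_right _ _)).le, hrε.le.trans hcon⟩
  have h1 := isMinOn_iff.1 hmin (q s, v s) (Metric.mem_sphere.2 hsr)
  have h2 := (h.energy_le hq0 (hsub hs)).2
  exact absurd (h1.trans h2) (not_le.2 hlow)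

theorem isLocallyAttractive (k : Gains) (d : Target p) : IsLocallyAttractive k d := by
  -- With angles below `1 / 4` the combinations `θ₁ - θ₃` and `θ₂ + θ₃` stay within `1 / 2`, so
  -- their cosines are at least `1 / 2`.
  obtain ⟨δ, hδ, hstab⟩ := isLyapunovStable k d (1 / 4) (by norm_num)
  obtain ⟨r, hr, hball⟩ := Metric.mem_nhds_iff.1 (inside_mem_nhds k d)
  refine ⟨min δ r, lt_min hδ hr, fun q v h h0 => ?_⟩
  have hnear : ∀ t ≥ 0, ∀ i : Fin 5, qd d i = 0 → -(1 / 4) ≤ q t i ∧ q t i ≤ 1 / 4 :=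
    fun t ht i hi => abs_le.1 (abs_angle_le (x := (q t, v t))
      (hstab (t + 1) q v (h.mono Ico_subset_Ici_self) (h0.trans_le (min_le_left _ _)) t
        ⟨ht, by linarith⟩).le hi)
  have hcos {x : ℝ} (h1 : -(1 / 2) ≤ x) (h2 : x ≤ 1 / 2) : 1 / 2 ≤ cos x := by
    have := one_sub_sq_div_two_le_cos (x := x)
    nlinarith
  have hπ := pi_gt_three
  have hangle : ∀ t ≥ 0, ∀ i : Fin 5, qd d i = 0 → -(π / 2) < q t i ∧ q t i < π / 2 :=
    fun t ht i hi => by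
      have := hnear t ht i hi
      constructor <;> linarith [this.1, this.2]
  have hc1 : ∀ t ≥ 0, 1 / 2 ≤ cos (q t 2 - q t 4) := fun t ht => by
    have h2 := hnear t ht 2 rfl
    have h4 := hnear t ht 4 rfl
    exact hcos (by linarith [h2.1, h4.2]) (by linarith [h2.2, h4.1])
  have hc2 : ∀ t ≥ 0, 1 / 2 ≤ cos (q t 3 + q t 4) := fun t ht => by
    have h3 := hnear t ht 3 rfl
    have h4 := hnear t ht 4 rfl
    exact hcos (by linarith [h3.1, h4.1]) (by linarith [h3.2, h4.2])
  refine converges_of_angleAssumption h ⟨fun t ht => hangle t ht 2 rfl,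
    fun t ht => hangle t ht 3 rfl, fun t ht => hangle t ht 4 rfl,
    fun t ht => one_half_pos.trans_le (hc1 t ht), fun t ht => one_half_pos.trans_le (hc2 t ht),
    1 / 2, one_half_pos, fun t ht => (hc1 t ht).trans (le_max_left _ _)⟩
    (hball (show dist (q 0, v 0) (qd d, 0) < r from h0.trans_le (min_le_right _ _)))

end DroneBar

theorem theorem1 (p : DroneBar.Plant) (k : DroneBar.Gains) (d : DroneBar.Target p) :
    DroneBar.IsEquilibrium k d ∧
    DroneBar.IsLyapunovStable k d ∧
    DroneBar.IsLocallyAttractive k d ∧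
    ∀ q v : ℝ → DroneBar.Conf,
      DroneBar.IsMotion k d (Set.Ici 0) q v →
      DroneBar.AngleAssumption q →
      |DroneBar.ey1 d (q 0) - DroneBar.ey2 d (q 0)| ^ 2 < k.ρ →
      DroneBar.Converges d q v := by
  refine ⟨DroneBar.isEquilibrium k d, DroneBar.isLyapunovStable k d,
    DroneBar.isLocallyAttractive k d, fun q v h hang h0 => ?_⟩
  rw [sq_abs] at h0
  exact DroneBar.converges_of_angleAssumption h hang h0
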